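/- Let $\mathcal C$ be one of the Wigner–Dyson classes A, AI, AII or the Bogoliubov–de Gennes classes B/D, C, CI, DIII. Put $\delta=1$ for A, AI, B/D and $\delta=2$ for AII, C, CI, DIII, and let $\mathbb M_n^{\mathcal C}\subset\mathbb C^{\delta n\times\delta n}$ be the following space of matrices. - A: hermitian $n\times n$ matrices. AI: real symmetric $n\times n$ matrices. B/D: skew symmetric $n\times n$ matrices with entries in $i\mathbb R$. - AII: $\begin{pmatrix}X_1&X_2\\-\overline{X_2}&\overline{X_1}\end{pmatrix}$ with $X_1,X_2\in\mathbb C^{n\times n}$, $X_1$ hermitian, $X_2$ skew symmetric. - C: $\begin{pmatrix}X_1&X_2\\\overline{X_2}&-\overline{X_1}\end{pmatrix}$ with $X_1,X_2\in\mathbb C^{n\times n}$, $X_1$ hermitian, $X_2$ symmetric. - CI: $\begin{pmatrix}X_1&X_2\\X_2&-X_1\end{pmatrix}$ with $X_1,X_2\in\mathbb R^{n\times n}$ symmetric. - DIII: $\begin{pmatrix}X_1&X_2\\X_2&-X_1\end{pmatrix}$ with $X_1,X_2\in(i\mathbb R)^{n\times n}$ skew symmetric. Let $I_N=\{1,\dots,N\}$,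 and let $J_n^{\mathcal C}\subset I_{\delta n}^2$ be the set of index pairs $(p,q)$ such that some matrix in $\mathbb M_n^{\mathcal C}$ has a nonzero $(p,q)$ entry. For each $n$ let $\sim_n$ be an equivalence relation on $I_{\delta n}^2$ and let $$X_n=\Big(\tfrac1{\sqrt{\delta n}}\,a_n(p,q)\Big)_{p,q\in I_{\delta n}}$$ be a random matrix all of whose realizations belong to $\mathbb M_n^{\mathcal C}$, where the $a_n(p,q)$ are complex random variables. Assume that entries belonging to distinct equivalence classes are independent, in the sense that each $a_n(p,q)$ is independent of the family $\big(a_n(p',q')\big)_{(p',q')\not\sim_n(p,q)}$. Assume moreover, as $n\to\infty$, - (W1) $\max_p\#\{(q,p',q')\in I_{\delta n}^3:(p,q)\sim_n(p',q')\}=o(n^2)$; - (W2) there is a constant $B<\infty$ with $\max_{p,q,p'}\#\{q'\in I_{\delta n}:(p,q)\sim_n(p',q')\}\le B$ for all $n$; - (W3) $\#\{(p,q,p')\in I_{\delta n}^3:(p,q)\sim_n(q,p'),\ p\ne p'\}=o(n^2)$; - $\mathbb E\,a_n(p,q)=0$ for all $n,p,q$; $\ \mathbb E|a_n(p,q)|^2=1$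 for all $n$ and all $(p,q)\in J_n^{\mathcal C}$; and $\sup_n\max_{p,q}\mathbb E|a_n(p,q)|^k<\infty$ for every $k\in\mathbb N$. Let $L_n=\frac1{\delta n}\sum_{j=1}^{\delta n}\delta_{\lambda_j}$ denote the empirical measure of the eigenvalues $\lambda_1,\dots,\lambda_{\delta n}$ of $X_n$. Then, as $n\to\infty$, the mean empirical eigenvalue distribution $\mathbb E(L_n)$ converges weakly to the semicircle law, which has density $\frac1{2\pi}1_{[-2,2]}(x)\sqrt{4-x^2}$. -/

import Mathlib

open MeasureTheory ProbabilityTheory Filter Topology Asymptotics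
open scoped ENNReal NNReal BoundedContinuousFunction

/-- The Wigner-Dyson classes (`A`, `AI`, `AII`) and the Bogolioubov-de Gennes classes
(`BD`, `C`, `CI`, `DIII`). -/
inductive SymClass where
  | A | AI | AII | BD | C | CI | DIII

namespace SymClass

/-- The factor `δ`: matrices of the class with parameter `n` have size `δ n × δ n`. -/
def delta : SymClass → ℕ
  | A | AI | BD => 1
  | AII | C | CI | DIII => 2

/-- Row and column indices. For the classes of `2 × 2` block matrices, the index set
`{1, …, 2n}` is realized as the disjoint union of its two halves. -/
def Index : SymClass → ℕ → Type
  | A, n | AI, n | BD, n => Fin n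
  | AII, n | C, n | CI, n | DIII, n => Fin n ⊕ Fin n

instance instFintypeIndex : (c : SymClass) → (n : ℕ) → Fintype (c.Index n)
  | A, n | AI, n | BD, n => inferInstanceAs (Fintype (Fin n))
  | AII, n | C, n | CI, n | DIII, n => inferInstanceAs (Fintype (Fin n ⊕ Fin n))

instance instDecidableEqIndex : (c : SymClass) → (n : ℕ) → DecidableEq (c.Index n)
  | A, n | AI, n | BD, n => inferInstanceAs (DecidableEq (Fin n))
  | AII, n | C, n | CI, n | DIII, n => inferInstanceAs (DecidableEq (Fin n ⊕ Fin n))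

theorem card_index (c : SymClass) (n : ℕ) : Fintype.card (c.Index n) = c.delta * n := by
  cases c
  case A => exact (Fintype.card_fin n).trans (one_mul n).symm
  case AI => exact (Fintype.card_fin n).trans (one_mul n).symm
  case BD => exact (Fintype.card_fin n).trans (one_mul n).symm
  all_goals
    exact (Fintype.card_sum (α := Fin n) (β := Fin n)).trans (by simp [delta, two_mul])

/-- All entries of the complex matrix are real. -/
def EntriesReal {ι : Type} (X : Matrix ι ι ℂ) : Prop := ∀ p q, (X p q).im = 0

/-- All entries of the complex matrix lie in `iℝ`. -/
def EntriesImaginary {ι : Type} (X : Matrix ι ι ℂ) : Prop := ∀ p q, (X p q).re = 0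

/-- The space of matrices belonging to each class. Here `Xᵀ = X` is symmetry, `Xᵀ = -X` is skew
symmetry, and `X.map star` is the entrywise complex conjugate. -/
def space : (c : SymClass) → (n : ℕ) → Set (Matrix (c.Index n) (c.Index n) ℂ)
  | A, n => {X : Matrix (Fin n) (Fin n) ℂ | X.IsHermitian}
  | AI, n => {X : Matrix (Fin n) (Fin n) ℂ | EntriesReal X ∧ X.transpose = X}
  | AII, n => {M : Matrix (Fin n ⊕ Fin n) (Fin n ⊕ Fin n) ℂ |
      ∃ X₁ X₂ : Matrix (Fin n) (Fin n) ℂ, X₁.IsHermitian ∧ X₂.transpose = -X₂ ∧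
        M = Matrix.fromBlocks X₁ X₂ (-(X₂.map star)) (X₁.map star)}
  | BD, n => {X : Matrix (Fin n) (Fin n) ℂ | EntriesImaginary X ∧ X.transpose = -X}
  | C, n => {M : Matrix (Fin n ⊕ Fin n) (Fin n ⊕ Fin n) ℂ |
      ∃ X₁ X₂ : Matrix (Fin n) (Fin n) ℂ, X₁.IsHermitian ∧ X₂.transpose = X₂ ∧
        M = Matrix.fromBlocks X₁ X₂ (X₂.map star) (-(X₁.map star))}
  | CI, n => {M : Matrix (Fin n ⊕ Fin n) (Fin n ⊕ Fin n) ℂ |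
      ∃ X₁ X₂ : Matrix (Fin n) (Fin n) ℂ, EntriesReal X₁ ∧ EntriesReal X₂ ∧
        X₁.transpose = X₁ ∧ X₂.transpose = X₂ ∧ M = Matrix.fromBlocks X₁ X₂ X₂ (-X₁)}
  | DIII, n => {M : Matrix (Fin n ⊕ Fin n) (Fin n ⊕ Fin n) ℂ |
      ∃ X₁ X₂ : Matrix (Fin n) (Fin n) ℂ, EntriesImaginary X₁ ∧ EntriesImaginary X₂ ∧
        X₁.transpose = -X₁ ∧ X₂.transpose = -X₂ ∧ M = Matrix.fromBlocks X₁ X₂ X₂ (-X₁)}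

/-- The index pairs at which not all matrices of the class vanish. -/
def support (c : SymClass) (n : ℕ) : Set (c.Index n × c.Index n) :=
  {t | ∃ M ∈ c.space n, M t.1 t.2 ≠ 0}

theorem conjTranspose_of_real {ι : Type} {X : Matrix ι ι ℂ} (h : EntriesReal X)
    (hs : X.transpose = X) : X.conjTranspose = X := by
  ext p q
  have h1 : X q p = X p q := congrFun (congrFun hs p) q
  rw [Matrix.conjTranspose_apply, h1]
  exact Complex.conj_eq_iff_im.2 (h p q)

theorem conjTranspose_of_imaginary {ι : Type} {X : Matrix ι ι ℂ} (h : EntriesImaginary X)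
    (hs : X.transpose = -X) : X.conjTranspose = X := by
  ext p q
  have h1 : X q p = -X p q := congrFun (congrFun hs p) q
  rw [Matrix.conjTranspose_apply, h1]
  apply Complex.ext <;> simp [h p q]

/-- Every matrix of each class is hermitian. -/
theorem isHermitian_of_mem {c : SymClass} {n : ℕ} {M : Matrix (c.Index n) (c.Index n) ℂ}
    (hM : M ∈ c.space n) : M.IsHermitian := by
  cases c
  case A => exact hM
  case AI => exact conjTranspose_of_real hM.1 hM.2
  case BD => exact conjTranspose_of_imaginary hM.1 hM.2
  case AII =>
    obtain ⟨X₁, X₂, h₁, h₂, rfl⟩ := hM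
    have e : ∀ p q, X₂ q p = -X₂ p q := fun p q => congrFun (congrFun h₂ p) q
    refine Matrix.IsHermitian.fromBlocks h₁ ?_ ?_
    · ext p q
      simp [Matrix.conjTranspose_apply, e p q]
    · ext p q
      simpa [Matrix.conjTranspose_apply] using (congrArg star (h₁.apply p q))
  case C =>
    obtain ⟨X₁, X₂, h₁, h₂, rfl⟩ := hM
    have e : ∀ p q, X₂ q p = X₂ p q := fun p q => congrFun (congrFun h₂ p) q
    refine Matrix.IsHermitian.fromBlocks h₁ ?_ ?_
    · ext p q
      simp [Matrix.conjTranspose_apply, e p q]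
    · ext p q
      simpa [Matrix.conjTranspose_apply] using (congrArg star (h₁.apply p q))
  case CI =>
    obtain ⟨X₁, X₂, r₁, r₂, h₁, h₂, rfl⟩ := hM
    have e₁ := conjTranspose_of_real r₁ h₁
    exact Matrix.IsHermitian.fromBlocks e₁ (conjTranspose_of_real r₂ h₂)
      (Matrix.IsHermitian.neg e₁)
  case DIII =>
    obtain ⟨X₁, X₂, r₁, r₂, h₁, h₂, rfl⟩ := hM
    have e₁ := conjTranspose_of_imaginary r₁ h₁
    exact Matrix.IsHermitian.fromBlocks e₁ (conjTranspose_of_imaginary r₂ h₂)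
      (Matrix.IsHermitian.neg e₁)

end SymClass

/-! The three conditions on a sequence of equivalence relations on pairs of indices; `ι n` is the
index set of the `n`-th matrix, and the `o`-terms refer to the square of its size. -/

/-- `max_p #{(q, p', q') : (p, q) ∼ (p', q')} = o(size²)`. -/
def ConditionW1 (ι : ℕ → Type) [∀ n, Fintype (ι n)] (r : ∀ n, Setoid (ι n × ι n)) : Prop :=
  (fun n => ((Finset.univ.sup fun p : ι n =>
      {t : ι n × ι n × ι n | r n (p, t.1) (t.2.1, t.2.2)}.ncard : ℕ) : ℝ))
    =o[atTop] fun n => (Fintype.card (ι n) : ℝ) ^ 2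

/-- `max_{p, q, p'} #{q' : (p, q) ∼ (p', q')} ≤ B` for a finite constant `B`. -/
def ConditionW2 (ι : ℕ → Type) (r : ∀ n, Setoid (ι n × ι n)) : Prop :=
  ∃ B : ℕ, ∀ n, ∀ p q p' : ι n, {q' : ι n | r n (p, q) (p', q')}.ncard ≤ B

/-- `#{(p, q, p') : (p, q) ∼ (q, p') and p ≠ p'} = o(size²)`. -/
def ConditionW3 (ι : ℕ → Type) [∀ n, Fintype (ι n)] (r : ∀ n, Setoid (ι n × ι n)) : Prop :=
  (fun n => ({t : ι n × ι n × ι n |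
      r n (t.1, t.2.1) (t.2.1, t.2.2) ∧ t.1 ≠ t.2.2}.ncard : ℝ))
    =o[atTop] fun n => (Fintype.card (ι n) : ℝ) ^ 2

/-- The empirical measure of the eigenvalues of a hermitian matrix. -/
noncomputable def empiricalMeasure {ι : Type} [Fintype ι] [DecidableEq ι]
    (M : Matrix ι ι ℂ) (hM : M.IsHermitian) : Measure ℝ :=
  (Fintype.card ι : ℝ≥0∞)⁻¹ • ∑ j, Measure.dirac (hM.eigenvalues j)

/-- The mean empirical eigenvalue distribution `B ↦ 𝔼 (L(X)(B))` of a random hermitian matrix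
`X`, where `L` is the empirical measure. -/
noncomputable def meanEmpiricalMeasure {ι : Type} [Fintype ι] [DecidableEq ι]
    {Ω : Type*} [MeasurableSpace Ω] (P : Measure Ω)
    (X : Ω → Matrix ι ι ℂ) (hX : ∀ ω, (X ω).IsHermitian) : Measure ℝ :=
  P.bind fun ω => empiricalMeasure (X ω) (hX ω)

/-- Weak convergence of a sequence of measures on `ℝ`. -/
def ConvergesWeakly (μ : ℕ → Measure ℝ) (ν : Measure ℝ) : Prop :=
  ∀ f : ℝ →ᵇ ℝ, Tendsto (fun n => ∫ x, f x ∂(μ n)) atTop (𝓝 (∫ x, f x ∂ν))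

/-- The random matrix `(N^{-1/2} a(p, q))_{p, q}` with `N` the size of the matrix. -/
noncomputable def scaledMatrix {ι : Type} [Fintype ι] {Ω : Type*} (a : ι → ι → Ω → ℂ) (ω : Ω) :
    Matrix ι ι ℂ :=
  Matrix.of fun p q => ((1 / Real.sqrt (Fintype.card ι) : ℝ) : ℂ) * a p q ω

/-- The semicircle law, with density `(2π)⁻¹ 1_{[-2,2]}(x) √(4 - x²)`. -/
noncomputable def semicircleLaw : Measure ℝ :=
  volume.withDensity fun x => ENNReal.ofReal
    (1 / (2 * Real.pi) * (Set.Icc (-2 : ℝ) 2).indicator (fun x => Real.sqrt (4 - x ^ 2)) x)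

/-! The proof is by the method of moments. The trace of `X ^ k` is a sum, over closed walks with `k`
steps, of products of entries along the walk. Since the matrix is hermitian and its entries have
unit variance where they are not forced to vanish, `(p, q)` and `(q, p)` must be equivalent there.
By centering and independence, a walk contributes only if it passes each of the equivalence classes
of its edges at least twice. Such a walk meets at most `k / 2` classes. By (W2), a step to a class
met before has boundedly many choices, so walks with fewer than `k / 2` classes are negligible.

A walk that passes each class exactly twice either is the contour of a tree, whose contribution
is `1`, or at some point takes a step to an old class other than the reversal of the last edge not
yet traversed back. By (W1) and (W3) such a step removes, up to `o(1)`, one degree of freedom.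
The tree walks, counted with the length of the path still to be traversed back, satisfy
asymptotically the recursion of the ballot numbers, and so do the moments of the semicircle law when
`x ^ k` is integrated against the Chebyshev polynomials of the second kind. Forced zeros do not
matter as long as there are `o(N)` of them in each row. -/

section Words

variable {ι : Type*}

/-- The finite set of words of length `k` over the alphabet `ι`. -/
noncomputable def words (ι : Type*) [Finite ι] (k : ℕ) : Finset (List ι) :=
  (List.finite_length_eq ι k).toFinset

/-- The number of words of length `k` over the alphabet `ι` with the property `p`. -/
noncomputable def wordCount (k : ℕ) (p : List ι → Prop) : ℕ :=
  {l : List ι | l.length = k ∧ p l}.ncard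

variable {k m : ℕ} {p p' : List ι → Prop}

theorem wordCount_eq_zero (h : ∀ l, l.length = k → ¬p l) : wordCount k p = 0 :=
  (congrArg Set.ncard (Set.eq_empty_of_forall_notMem fun l hl => h l hl.1 hl.2)).trans
    (Set.ncard_empty _)

variable [Finite ι]

@[simp] theorem mem_words {l : List ι} : l ∈ words ι k ↔ l.length = k := by
  simp [words]

theorem sum_words_zero {M : Type*} [AddCommMonoid M] (f : List ι → M) :
    ∑ l ∈ words ι 0, f l = f [] := by
  have h : words ι 0 = {[]} := by ext l; simp
  rw [h, Finset.sum_singleton]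

theorem finite_setOf_word (k : ℕ) (p : List ι → Prop) :
    {l : List ι | l.length = k ∧ p l}.Finite :=
  (List.finite_length_eq ι k).subset fun _ hl => hl.1

theorem wordCount_eq_card [DecidablePred p] : wordCount k p = ((words ι k).filter p).card := by
  rw [wordCount, ← Set.ncard_coe_finset]
  congr! 1
  ext l
  simp

theorem wordCount_mono (h : ∀ l, l.length = k → p l → p' l) : wordCount k p ≤ wordCount k p' :=
  Set.ncard_le_ncard (fun l hl => ⟨hl.1, h l hl.1 hl.2⟩) (finite_setOf_word k p')

theorem wordCount_le_add {p₁ p₂ : List ι → Prop} (h : ∀ l, l.length = k → p l → p₁ l ∨ p₂ l) :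
    wordCount k p ≤ wordCount k p₁ + wordCount k p₂ :=
  (Set.ncard_le_ncard (fun l hl => (h l hl.1 hl.2).imp (⟨hl.1, ·⟩) (⟨hl.1, ·⟩))
    ((finite_setOf_word k p₁).union (finite_setOf_word k p₂))).trans (Set.ncard_union_le _ _)

theorem wordCount_add_le {p₁ p₂ : List ι → Prop} (h₁ : ∀ l, p₁ l → p l) (h₂ : ∀ l, p₂ l → p l)
    (hdisj : ∀ l, p₁ l → ¬p₂ l) : wordCount k p₁ + wordCount k p₂ ≤ wordCount k p := by
  rw [wordCount, wordCount, ← Set.ncard_union_eq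
    (Set.disjoint_left.2 fun l hl hl' => hdisj l hl.2 hl'.2) (finite_setOf_word k p₁)
    (finite_setOf_word k p₂)]
  refine Set.ncard_le_ncard (Set.union_subset ?_ ?_) (finite_setOf_word k p)
  · exact fun l hl => ⟨hl.1, h₁ l hl.2⟩
  · exact fun l hl => ⟨hl.1, h₂ l hl.2⟩

theorem wordCount_exists_le {α : Type*} [Fintype α] (k : ℕ) (p : α → List ι → Prop) :
    wordCount k (fun l => ∃ a, p a l) ≤ ∑ a, wordCount k (p a) := by
  classical
  simp only [wordCount_eq_card]
  refine (Finset.card_le_card fun l hl => ?_).trans Finset.card_biUnion_le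
  simpa using hl

theorem wordCount_le_mul_wordCount {c : ℕ} (R : List ι → List ι → Prop)
    (hR : ∀ l, l.length = k → p l → ∃ s, s.length = m ∧ p' s ∧ R l s)
    (hc : ∀ s, s.length = m → p' s → wordCount k (fun l => p l ∧ R l s) ≤ c) :
    wordCount k p ≤ c * wordCount m p' := by
  classical
  simp only [wordCount_eq_card] at hc ⊢
  rw [mul_comm, ← mul_one (Finset.card _)]
  refine Finset.card_mul_le_card_mul R (fun l hl => ?_) fun s hs => ?_
  · rw [Finset.mem_filter, mem_words] at hl
    obtain ⟨s, hs, hs', hls⟩ := hR l hl.1 hl.2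
    exact Finset.card_pos.2 ⟨s, by simp [hs, hs', hls]⟩
  · rw [Finset.mem_filter, mem_words] at hs
    rw [Finset.bipartiteBelow, Finset.filter_filter]
    exact hc s hs.1 hs.2

theorem wordCount_le_ncard_mul {α : Type*} {A : Set α} (hA : A.Finite) (f : α → List ι → List ι)
    (h : ∀ l, l.length = k → p l → ∃ a ∈ A, ∃ s, s.length = m ∧ p' s ∧ l = f a s) :
    wordCount k p ≤ A.ncard * wordCount m p' := by
  rw [wordCount, wordCount, ← Set.ncard_prod]
  have hfin := hA.prod (finite_setOf_word m p')
  refine (Set.ncard_le_ncard ?_ (hfin.image fun x => f x.1 x.2)).trans (Set.ncard_image_le hfin)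
  rintro l ⟨hl, hp⟩
  obtain ⟨a, ha, s, hs, hs', rfl⟩ := h l hl hp
  exact ⟨(a, s), ⟨ha, hs, hs'⟩, rfl⟩

theorem wordCount_succ_le_mul {c : ℕ} (h : ∀ q l, l.length = k → p (q :: l) → p' l)
    (hc : ∀ l, l.length = k → p' l → {q | p (q :: l)}.ncard ≤ c) :
    wordCount (k + 1) p ≤ c * wordCount k p' := by
  refine wordCount_le_mul_wordCount (fun l s => l.tail = s) (fun l hl hp => ?_) fun s hs hs' => ?_
  · obtain ⟨q, l, rfl⟩ := List.exists_cons_of_length_eq_add_one hl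
    exact ⟨l, by simpa using hl, h q l (by simpa using hl) hp, rfl⟩
  · refine le_trans (Set.ncard_le_ncard ?_ (Set.toFinite _)) <|
      (Set.ncard_image_le (Set.toFinite _) (f := (· :: s))).trans (hc s hs hs')
    rintro l ⟨hl, hp, rfl⟩
    obtain ⟨q, l, rfl⟩ := List.exists_cons_of_length_eq_add_one hl
    exact ⟨q, hp, rfl⟩

end Words

section WordSums

variable {ι : Type*} [Fintype ι]

theorem sum_words_succ {M : Type*} [AddCommMonoid M] (f : List ι → M) (k : ℕ) :
    ∑ l ∈ words ι (k + 1), f l = ∑ q, ∑ l ∈ words ι k, f (q :: l) := by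
  rw [← Finset.sum_product']
  refine (Finset.sum_nbij (fun x : ι × List ι => x.1 :: x.2) ?_ ?_ ?_ fun _ _ => rfl).symm
  · simp
  · rintro ⟨a, b⟩ - ⟨c, d⟩ - h
    simpa using h
  · intro l hl
    obtain ⟨q, l, rfl⟩ := List.exists_cons_of_length_eq_add_one (mem_words.1 hl)
    exact ⟨(q, l), by simpa using hl, rfl⟩

theorem card_words (k : ℕ) : (words ι k).card = Fintype.card ι ^ k := by
  induction k with
  | zero => rw [Finset.card_eq_sum_ones, sum_words_zero, pow_zero]
  | succ k ih =>
    rw [Finset.card_eq_sum_ones, sum_words_succ]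
    simp [ih, pow_succ']

theorem wordCount_succ (k : ℕ) (p : List ι → Prop) :
    wordCount (k + 1) p = ∑ q, wordCount k fun l => p (q :: l) := by
  classical simp only [wordCount_eq_card, Finset.card_filter, sum_words_succ]

theorem wordCount_tail (k : ℕ) (p : List ι → Prop) :
    wordCount (k + 1) (fun l => p l.tail) = Fintype.card ι * wordCount k p := by
  simp only [wordCount_succ, List.tail_cons, Finset.sum_const, Finset.card_univ, smul_eq_mul]

theorem wordCount_true (k : ℕ) : wordCount k (fun _ : List ι => True) = Fintype.card ι ^ k := by
  rw [wordCount_eq_card, Finset.filter_true, card_words]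

end WordSums

section Walks

variable {ι : Type*}

/-- The edges of a walk. A walk is encoded by the list of its vertices in reverse order, the most
recent vertex first, so that a walk is extended by a step through `List.cons`. -/
def edges (l : List ι) : List (ι × ι) := l.tail.zip l

@[simp] theorem edges_nil : edges ([] : List ι) = [] := rfl

@[simp] theorem edges_singleton (p : ι) : edges [p] = [] := rfl

@[simp] theorem edges_cons_cons (q p : ι) (l : List ι) :
    edges (q :: p :: l) = (p, q) :: edges (p :: l) := rfl

theorem length_edges (l : List ι) : (edges l).length = l.length - 1 := by
  simp [edges]

variable (r : Setoid (ι × ι))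

/-- The equivalence classes of the edges of a walk, in the order of the edges. -/
def classList (l : List ι) : List (Quotient r) := (edges l).map (Quotient.mk r)

/-- The number of equivalence classes met by a walk. -/
noncomputable def numClasses (l : List ι) : ℕ :=
  open Classical in (classList r l).toFinset.card

/-- The number of times a walk passes an edge equivalent to `e`. -/
noncomputable def visits (l : List ι) (e : ι × ι) : ℕ :=
  open Classical in (classList r l).count (Quotient.mk r e)

@[simp] theorem classList_cons_cons (q p : ι) (l : List ι) :
    classList r (q :: p :: l) = Quotient.mk r (p, q) :: classList r (p :: l) := rfl

theorem mem_classList {l : List ι} {e : ι × ι} :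
    Quotient.mk r e ∈ classList r l ↔ ∃ e' ∈ edges l, r e' e := by
  simp only [classList, List.mem_map]
  exact exists_congr fun e' => and_congr_right fun _ => Quotient.eq

@[simp] theorem numClasses_singleton (p : ι) : numClasses r [p] = 0 := rfl

theorem numClasses_of_old {q p : ι} {l : List ι} (h : ∃ e ∈ edges (p :: l), r e (p, q)) :
    numClasses r (q :: p :: l) = numClasses r (p :: l) := by
  simp [numClasses, (mem_classList r).2 h]

theorem numClasses_of_new {q p : ι} {l : List ι} (h : ¬∃ e ∈ edges (p :: l), r e (p, q)) :
    numClasses r (q :: p :: l) = numClasses r (p :: l) + 1 := by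
  simp [numClasses, mt (mem_classList r).1 h]

theorem visits_le_visits_cons (q : ι) (l : List ι) (e : ι × ι) :
    visits r l e ≤ visits r (q :: l) e := by
  cases l with
  | nil => exact Nat.zero_le _
  | cons p l => classical exact List.count_le_count_cons

variable {r}

theorem visits_cons_of_equiv {q p : ι} {l : List ι} {e : ι × ι} (h : r (p, q) e) :
    visits r (q :: p :: l) e = visits r (p :: l) e + 1 := by
  classical rw [visits, classList_cons_cons, Quotient.sound h, List.count_cons_self, visits]

theorem visits_pos {l : List ι} {e : ι × ι} : 0 < visits r l e ↔ ∃ e' ∈ edges l, r e' e := by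
  classical exact List.count_pos_iff.trans (mem_classList r)

theorem sum_count_classList [DecidableEq (Quotient r)] (l : List ι) :
    ∑ c ∈ (classList r l).toFinset, (classList r l).count c = l.length - 1 := by
  rw [List.sum_toFinset_count_eq_length, classList, List.length_map, length_edges]

theorem numClasses_of_two_le_visits {l : List ι} (h : ∀ e ∈ edges l, 2 ≤ visits r l e) :
    2 * numClasses r l < l.length - 1 ∨
      2 * numClasses r l = l.length - 1 ∧ ∀ e ∈ edges l, visits r l e = 2 := by
  classical
  have hcount : ∀ c ∈ (classList r l).toFinset, 2 ≤ (classList r l).count c := by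
    intro c hc
    obtain ⟨e, he, rfl⟩ := List.mem_map.1 (List.mem_toFinset.1 hc)
    exact h e he
  have hsum : ∑ c ∈ (classList r l).toFinset, 2 = 2 * numClasses r l := by
    rw [Finset.sum_const, smul_eq_mul, mul_comm, numClasses]
  have hle := Finset.sum_le_sum hcount
  rw [sum_count_classList, hsum] at hle
  refine hle.lt_or_eq.imp_right fun heq => ⟨heq, fun e he => ?_⟩
  have := (Finset.sum_eq_sum_iff_of_le hcount).1 (by rw [sum_count_classList, hsum, heq])
    (Quotient.mk r e) (List.mem_toFinset.2 (List.mem_map_of_mem he))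
  rw [visits, this]

end Walks

section WalkCounting

variable {ι : Type*} {r : Setoid (ι × ι)}

theorem ncard_setOf_exists_edge_le [Finite ι] {B : ℕ}
    (hB : ∀ p q p' : ι, {q' : ι | r (p, q) (p', q')}.ncard ≤ B) (p : ι) (L : List (ι × ι)) :
    {q | ∃ e ∈ L, r e (p, q)}.ncard ≤ L.length * B := by
  induction L with
  | nil => simp
  | cons e L ih =>
    have hunion : {q | ∃ e' ∈ e :: L, r e' (p, q)} =
        {q | r e (p, q)} ∪ {q | ∃ e' ∈ L, r e' (p, q)} := by
      ext q
      simp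
    rw [hunion, List.length_cons, add_mul, one_mul, add_comm]
    exact (Set.ncard_union_le _ _).trans (add_le_add (hB e.1 e.2 p) ih)

variable [Fintype ι] {B : ℕ} (hB : ∀ p q p' : ι, {q' : ι | r (p, q) (p', q')}.ncard ≤ B)

include hB

/-- A step to a new equivalence class has at most `card ι` choices, a step to one of the classes
met before has boundedly many. -/
theorem wordCount_tail_numClasses_le (P : List ι → Prop) (Q : ℕ → Prop) (k : ℕ) :
    wordCount (k + 2) (fun l => P l.tail ∧ Q (numClasses r l)) ≤
      Fintype.card ι * wordCount (k + 1) (fun l => P l ∧ Q (numClasses r l + 1)) +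
        k * B * wordCount (k + 1) (fun l => P l ∧ Q (numClasses r l)) := by
  let new (l : List ι) : Prop := P l.tail ∧ Q (numClasses r l.tail + 1)
  let old (l : List ι) : Prop :=
    P l.tail ∧ Q (numClasses r l.tail) ∧ ∃ q p l', l = q :: p :: l' ∧
      ∃ e ∈ edges (p :: l'), r e (p, q)
  have hsplit : wordCount (k + 2) (fun l => P l.tail ∧ Q (numClasses r l)) ≤
      wordCount (k + 2) new + wordCount (k + 2) old := by
    refine wordCount_le_add ?_
    rintro (_ | ⟨q, _ | ⟨p, l⟩⟩) hl ⟨hP, hQ⟩ <;> simp only [List.length_cons, List.length_nil] at hl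
    · omega
    · omega
    by_cases h : ∃ e ∈ edges (p :: l), r e (p, q)
    · rw [numClasses_of_old r h] at hQ
      exact Or.inr ⟨hP, hQ, q, p, l, rfl, h⟩
    · rw [numClasses_of_new r h] at hQ
      exact Or.inl ⟨hP, hQ⟩
  refine hsplit.trans (add_le_add ?_ ?_)
  · refine wordCount_succ_le_mul (fun q l _ h => h) fun l _ _ => ?_
    exact (Set.ncard_le_card _).trans_eq Nat.card_eq_fintype_card
  · refine wordCount_succ_le_mul (fun q l _ h => ⟨h.1, h.2.1⟩) fun l hl _ => ?_
    obtain ⟨p, l, rfl⟩ := List.exists_cons_of_length_eq_add_one hl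
    have hold := ncard_setOf_exists_edge_le hB p (edges (p :: l))
    rw [length_edges, hl, Nat.add_sub_cancel] at hold
    refine (Set.ncard_le_ncard ?_ (Set.toFinite _)).trans hold
    rintro q ⟨-, -, _, _, _, h, he⟩
    simp only [List.cons.injEq] at h
    obtain ⟨rfl, rfl, rfl⟩ := h
    exact he

theorem wordCount_numClasses_le (k u : ℕ) :
    wordCount (k + 1) (fun l => numClasses r l ≤ u) ≤
      (1 + k * B) ^ k * Fintype.card ι ^ (u + 1) := by
  induction k generalizing u with
  | zero =>
    calc _ ≤ _ := wordCount_mono fun _ _ _ => trivial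
      _ = Fintype.card ι := (wordCount_true 1).trans (pow_one _)
      _ ≤ Fintype.card ι ^ (u + 1) := Nat.le_self_pow u.succ_ne_zero _
      _ = _ := by rw [pow_zero, one_mul]
  | succ k ih =>
    have hstep := wordCount_tail_numClasses_le hB (fun _ => True) (· ≤ u) k
    simp only [true_and] at hstep
    have hnew : Fintype.card ι * wordCount (k + 1) (fun l => numClasses r l + 1 ≤ u) ≤
        (1 + k * B) ^ k * Fintype.card ι ^ (u + 1) := by
      cases u with
      | zero => simp [wordCount_eq_zero]
      | succ u =>
        simp only [Nat.add_le_add_iff_right]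
        exact (Nat.mul_le_mul_left _ (ih u)).trans_eq (by ring)
    calc _ ≤ _ := hstep
      _ ≤ (1 + k * B) ^ k * Fintype.card ι ^ (u + 1) +
          k * B * ((1 + k * B) ^ k * Fintype.card ι ^ (u + 1)) :=
        add_le_add hnew (Nat.mul_le_mul_left _ (ih u))
      _ = (1 + k * B) ^ (k + 1) * Fintype.card ι ^ (u + 1) := by ring
      _ ≤ _ := by gcongr; omega

end WalkCounting

/-- `TreeWalk r S l s`: each step of the walk `l` either passes an edge of `S` of a new equivalence
class, or goes back along the last edge that has not yet been traversed back. The second argument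
is the stack of vertices on the path that remains to be traversed back, the most recent first. -/
inductive TreeWalk {ι : Type*} (r : Setoid (ι × ι)) (S : Set (ι × ι)) : List ι → List ι → Prop
  | start (p : ι) : TreeWalk r S [p] [p]
  | push {p q : ι} {l s : List ι} : TreeWalk r S (p :: l) (p :: s) → (p, q) ∈ S →
      (¬∃ e ∈ edges (p :: l), r e (p, q)) → TreeWalk r S (q :: p :: l) (q :: p :: s)
  | pop {p q : ι} {l s : List ι} : TreeWalk r S (p :: l) (p :: q :: s) →
      TreeWalk r S (q :: p :: l) (q :: s)

namespace TreeWalk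

variable {ι : Type*} {r : Setoid (ι × ι)} {S : Set (ι × ι)} {l s : List ι}

theorem stack_ne_nil (h : TreeWalk r S l s) : s ≠ [] := by
  cases h <;> exact List.cons_ne_nil _ _

theorem exists_stack_eq_cons {p : ι} (h : TreeWalk r S (p :: l) s) : ∃ t, s = p :: t := by
  cases h <;> exact ⟨_, rfl⟩

theorem length_stack_le (h : TreeWalk r S l s) : s.length ≤ l.length := by
  induction h with
  | start _ => rfl
  | push _ _ _ ih | pop _ ih => simp only [List.length_cons] at *; omega

theorem getLast?_stack (h : TreeWalk r S l s) : s.getLast? = l.getLast? := by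
  induction h with
  | start _ => rfl
  | push _ _ _ ih => rwa [List.getLast?_cons_cons, List.getLast?_cons_cons]
  | pop _ ih => rw [List.getLast?_cons_cons, ← ih, List.getLast?_cons_cons]

theorem edges_stack_subset (h : TreeWalk r S l s) : edges s ⊆ edges l := by
  induction h with
  | start _ => simp
  | push _ _ _ ih => exact List.cons_subset_cons _ ih
  | pop _ ih => exact fun e he => List.mem_cons_of_mem _ (ih (List.mem_cons_of_mem _ he))

theorem mem_of_mem_edges_stack (h : TreeWalk r S l s) : ∀ e ∈ edges s, e ∈ S := by
  induction h with
  | start _ => simp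
  | push _ hS _ ih => exact List.forall_mem_cons.2 ⟨hS, ih⟩
  | pop _ ih => exact (List.forall_mem_cons.1 ih).2

/-- `F` lists the edges that have been traversed back. -/
theorem exists_edges_perm (h : TreeWalk r S l s) : ∃ F : List (ι × ι),
    (∀ e ∈ F ++ edges s, e ∈ S ∧ e ∈ edges l) ∧ (F ++ edges s).Pairwise (fun e e' => ¬r e e') ∧
    (edges l).Perm (F.flatMap (fun e => [e, e.swap]) ++ edges s) := by
  have hsymm : ∀ {e e' : ι × ι}, ¬r e e' → ¬r e' e := fun h h' => h (r.symm h')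
  induction h with
  | start _ => exact ⟨[], by simp, by simp, by simp⟩
  | @push p q l s _ hS hn ih =>
    obtain ⟨F, hF, hpair, hwalk⟩ := ih
    have hperm : (F ++ edges (q :: p :: s)).Perm ((p, q) :: (F ++ edges (p :: s))) :=
      List.perm_middle
    refine ⟨F, fun e he => ?_, ?_, (hwalk.cons _).trans List.perm_middle.symm⟩
    · rcases List.mem_cons.1 (hperm.mem_iff.1 he) with rfl | he
      · exact ⟨hS, List.mem_cons_self⟩
      · exact ⟨(hF e he).1, List.mem_cons_of_mem _ (hF e he).2⟩
    · rw [hperm.pairwise_iff hsymm, List.pairwise_cons]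
      exact ⟨fun e he hr => hn ⟨e, (hF e he).2, r.symm hr⟩, hpair⟩
  | @pop p q l s _ ih =>
    obtain ⟨F, hF, hpair, hwalk⟩ := ih
    have hperm : (F ++ edges (p :: q :: s)).Perm ((q, p) :: F ++ edges (q :: s)) :=
      List.perm_middle
    refine ⟨(q, p) :: F, fun e he => ?_, (hperm.pairwise_iff hsymm).1 hpair,
      (hwalk.cons _).trans ?_⟩
    · obtain ⟨heS, hel⟩ := hF e (hperm.mem_iff.2 he)
      exact ⟨heS, List.mem_cons_of_mem _ hel⟩
    · exact (List.perm_middle.cons _).trans (.swap _ _ _)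

variable (hswap : ∀ p q, (p, q) ∈ S → r (p, q) (q, p))

include hswap

theorem exists_equiv_of_pop {p q : ι} (h : TreeWalk r S (p :: l) (p :: q :: s)) :
    ∃ e ∈ edges (p :: l), r e (p, q) := by
  have hqp : (q, p) ∈ edges (p :: q :: s) := List.mem_cons_self
  exact ⟨(q, p), h.edges_stack_subset hqp, hswap _ _ (h.mem_of_mem_edges_stack _ hqp)⟩

theorem stack_unique (h : TreeWalk r S l s) {s' : List ι} (h' : TreeWalk r S l s') : s = s' := by
  induction h generalizing s' with
  | start _ =>
    cases h'
    rfl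
  | push _ _ hn ih =>
    cases h' with
    | push h' => rw [ih h']
    | pop h' => exact absurd (h'.exists_equiv_of_pop hswap) hn
  | pop h ih =>
    cases h' with
    | push h' _ hn => exact absurd (h.exists_equiv_of_pop hswap) hn
    | pop h' => exact (List.cons.inj (ih h')).2

theorem two_mul_numClasses (h : TreeWalk r S l s) :
    2 * numClasses r l + 2 = l.length + s.length := by
  induction h with
  | start _ => simp
  | push _ _ hn ih =>
    rw [numClasses_of_new r hn]
    simp only [List.length_cons] at *
    omega
  | pop h ih =>
    rw [numClasses_of_old r (h.exists_equiv_of_pop hswap)]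
    simp only [List.length_cons] at *
    omega

theorem equiv_stack_or_two_le_visits (h : TreeWalk r S l s) {e : ι × ι} (he : e ∈ edges l) :
    (∃ e' ∈ edges s, r e' e) ∨ 2 ≤ visits r l e := by
  induction h with
  | start _ => simp at he
  | push _ _ _ ih =>
    rcases List.mem_cons.1 he with rfl | he
    · exact Or.inl ⟨_, List.mem_cons_self, r.refl _⟩
    · exact (ih he).imp (fun ⟨e', he', hr⟩ => ⟨e', List.mem_cons_of_mem _ he', hr⟩)
        fun h2 => h2.trans (visits_le_visits_cons r _ _ _)
  | @pop p q l s h ih =>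
    by_cases hpq : r (p, q) e
    · obtain ⟨e₀, he₀, hr₀⟩ := h.exists_equiv_of_pop hswap
      have hpos : 0 < visits r (p :: l) e := visits_pos.2 ⟨e₀, he₀, r.trans hr₀ hpq⟩
      exact Or.inr ((Nat.succ_le_succ hpos).trans_eq (visits_cons_of_equiv hpq).symm)
    · rcases List.mem_cons.1 he with rfl | he
      · exact absurd (r.refl _) hpq
      refine (ih he).imp (fun ⟨e', he', hr⟩ => ⟨e', ?_, hr⟩)
        fun h2 => h2.trans (visits_le_visits_cons r _ _ _)
      refine List.mem_of_ne_of_mem ?_ he'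
      rintro rfl
      have hqp : r (q, p) (p, q) := hswap _ _ (h.mem_of_mem_edges_stack _ List.mem_cons_self)
      exact hpq (r.trans (r.symm hqp) hr)

end TreeWalk

section TreeWalkCounting

variable {ι : Type*} [Fintype ι] {r : Setoid (ι × ι)} {S : Set (ι × ι)}

theorem wordCount_treeWalk_cons_le (k : ℕ) (q : ι) (t : List ι) :
    wordCount (k + 2) (fun l => TreeWalk r S l (q :: t)) ≤
      wordCount (k + 1) (fun l => TreeWalk r S l t) +
        ∑ p, wordCount (k + 1) fun l => TreeWalk r S l (p :: q :: t) := by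
  have hpred : ∀ l, l.length = k + 2 → TreeWalk r S l (q :: t) → ∃ x ∈ ({q} : Set ι), ∃ l',
      l'.length = k + 1 ∧ (TreeWalk r S l' t ∨ ∃ p, TreeWalk r S l' (p :: q :: t)) ∧
        l = x :: l' := by
    intro l hl h
    cases h with
    | start => simp at hl
    | push h => exact ⟨q, rfl, _, by simpa using hl, Or.inl h, rfl⟩
    | pop h => exact ⟨q, rfl, _, by simpa using hl, Or.inr ⟨_, h⟩, rfl⟩
  refine (wordCount_le_ncard_mul (Set.finite_singleton q) List.cons hpred).trans ?_
  rw [Set.ncard_singleton, one_mul]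
  refine (wordCount_le_add fun _ _ h => h).trans (Nat.add_le_add_left ?_ _)
  exact wordCount_exists_le _ _

theorem wordCount_treeWalk_stack_le (k : ℕ) (s : List ι) (e : ℕ) (h : 2 * e + s.length = k + 1) :
    wordCount (k + 1) (fun l => TreeWalk r S l s) ≤ 2 ^ k * Fintype.card ι ^ e := by
  induction k generalizing s e with
  | zero =>
    refine (wordCount_le_ncard_mul (m := 0) (p' := fun _ => True) (Set.finite_singleton s)
      (fun s _ => s) fun l hl hw => ?_).trans ?_
    · obtain ⟨p, rfl⟩ := List.length_eq_one_iff.1 hl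
      cases hw
      exact ⟨[p], rfl, [], rfl, trivial, rfl⟩
    · obtain rfl : e = 0 := by omega
      rw [wordCount_true, Set.ncard_singleton, pow_zero, pow_zero]
  | succ k ih =>
    rcases s with _ | ⟨q, t⟩
    · exact (wordCount_eq_zero fun l _ hl => hl.stack_ne_nil rfl).trans_le (Nat.zero_le _)
    rw [List.length_cons] at h
    have hpush : wordCount (k + 1) (fun l => TreeWalk r S l t) ≤ 2 ^ k * Fintype.card ι ^ e :=
      ih t e (by omega)
    have hpop : ∑ p, wordCount (k + 1) (fun l => TreeWalk r S l (p :: q :: t)) ≤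
        2 ^ k * Fintype.card ι ^ e := by
      cases e with
      | zero =>
        refine (Finset.sum_eq_zero fun p _ => ?_).trans_le (Nat.zero_le _)
        refine wordCount_eq_zero fun l hl hw => ?_
        have := hw.length_stack_le
        simp only [List.length_cons] at this
        omega
      | succ e =>
        refine (Finset.sum_le_card_nsmul _ _ _ fun p _ => ih (p :: q :: t) e ?_).trans_eq ?_
        · simp only [List.length_cons]
          omega
        · rw [Finset.card_univ, smul_eq_mul]
          ring
    calc _ ≤ _ := wordCount_treeWalk_cons_le k q t
      _ ≤ 2 ^ k * Fintype.card ι ^ e + 2 ^ k * Fintype.card ι ^ e := add_le_add hpush hpop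
      _ = _ := by ring

end TreeWalkCounting

section StrayWords

variable {ι : Type*} [Fintype ι]

theorem ncard_setOf_prod {α β : Type*} [Finite α] [Fintype β] (p : α × β → Prop) :
    {x | p x}.ncard = ∑ b, {a | p (a, b)}.ncard := by
  classical
  have := Fintype.ofFinite α
  simp only [Set.ncard_eq_toFinset_card', Set.toFinset_ofPred, Finset.card_filter,
    Fintype.sum_prod_type]
  exact Finset.sum_comm

theorem wordCount_head_edge_le (R : Set (ι × ι)) (k : ℕ) :
    Fintype.card ι ^ 2 * wordCount (k + 1) (fun l => ∃ e ∈ (edges l).head?, e ∈ R) ≤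
      Fintype.card ι ^ (k + 1) * R.ncard := by
  cases k with
  | zero =>
    rw [wordCount_eq_zero, mul_zero]
    · exact Nat.zero_le _
    · rintro l hl
      obtain ⟨p, rfl⟩ := List.length_eq_one_iff.1 hl
      simp
  | succ k =>
    have hle := wordCount_le_ncard_mul (k := k + 2) (m := k) (p' := fun _ => True)
      (p := fun l : List ι => ∃ e ∈ (edges l).head?, e ∈ R) R.toFinite
      (fun e t => e.2 :: e.1 :: t) ?_
    · rw [wordCount_true] at hle
      exact (Nat.mul_le_mul_left _ hle).trans_eq (by ring)
    · rintro (_ | ⟨q, _ | ⟨p, l⟩⟩) hl h <;> simp_all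

theorem wordCount_exists_edge_le (R : Set (ι × ι)) (k : ℕ) :
    Fintype.card ι ^ 2 * wordCount k (fun l => ∃ e ∈ edges l, e ∈ R) ≤
      k * Fintype.card ι ^ k * R.ncard := by
  induction k with
  | zero =>
    rw [wordCount_eq_zero fun l hl => by simp [List.length_eq_zero_iff.1 hl]]
    simp
  | succ k ih =>
    have hsplit : wordCount (k + 1) (fun l => ∃ e ∈ edges l, e ∈ R) ≤
        wordCount (k + 1) (fun l => ∃ e ∈ (edges l).head?, e ∈ R) +
          wordCount (k + 1) (fun l => ∃ e ∈ edges l.tail, e ∈ R) := by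
      refine wordCount_le_add ?_
      rintro (_ | ⟨q, _ | ⟨p, l⟩⟩) - h <;> simp_all
    have htail : wordCount (k + 1) (fun l => ∃ e ∈ edges l.tail, e ∈ R) ≤
        Fintype.card ι * wordCount k (fun l => ∃ e ∈ edges l, e ∈ R) :=
      wordCount_succ_le_mul (fun _ _ _ h => h) fun _ _ _ =>
        (Set.ncard_le_card _).trans_eq Nat.card_eq_fintype_card
    calc _ ≤ _ := Nat.mul_le_mul_left _ (hsplit.trans (Nat.add_le_add_left htail _))
      _ = _ := by rw [mul_add, mul_left_comm]
      _ ≤ Fintype.card ι ^ (k + 1) * R.ncard +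
          Fintype.card ι * (k * Fintype.card ι ^ k * R.ncard) :=
        add_le_add (wordCount_head_edge_le R k) (Nat.mul_le_mul_left _ ih)
      _ = _ := by ring

variable (r : Setoid (ι × ι))

/-- The last step of the walk is equivalent to an edge before the last two steps, or to the step
preceding it, although it does not reverse that step. -/
def Stray : List ι → Prop
  | q :: p :: t =>
    (∃ e ∈ edges t, r e (p, q)) ∨ ∃ p₁ ∈ t.head?, r (p₁, p) (p, q) ∧ p₁ ≠ q
  | _ => False

/-- The number of pairs of equivalent edges. -/
noncomputable def equivCount : ℕ := {x : (ι × ι) × (ι × ι) | r x.1 x.2}.ncard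

/-- The number of paths of length two with equivalent edges which do not return to their starting
point, as in condition (W3). -/
noncomputable def pathCount : ℕ :=
  {t : ι × ι × ι | r (t.1, t.2.1) (t.2.1, t.2.2) ∧ t.1 ≠ t.2.2}.ncard

/-- The deviation of the equivalence relation from the one that identifies `(p, q)` and `(q, p)`
only, measured by the quantities that (W1) and (W3) control; it is `o(N ^ 3)`. -/
noncomputable def defect : ℕ := equivCount r + Fintype.card ι * pathCount r

theorem wordCount_equiv_edge_le (m : ℕ) :
    Fintype.card ι ^ 2 * wordCount (m + 2)
        (fun l => ∃ q p t, l = q :: p :: t ∧ ∃ e ∈ edges t, r e (p, q)) ≤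
      m * Fintype.card ι ^ m * equivCount r := by
  have hsum : equivCount r = ∑ q, ∑ p, {e | r e (p, q)}.ncard := by
    rw [equivCount, ncard_setOf_prod, Fintype.sum_prod_type_right]
  rw [wordCount_succ, hsum, Finset.mul_sum, Finset.mul_sum]
  refine Finset.sum_le_sum fun q _ => ?_
  rw [wordCount_succ, Finset.mul_sum, Finset.mul_sum]
  refine Finset.sum_le_sum fun p _ => ?_
  refine (Nat.mul_le_mul_left _ (wordCount_mono ?_)).trans
    (wordCount_exists_edge_le {e | r e (p, q)} m)
  rintro t - ⟨_, _, _, h, he⟩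
  simp only [List.cons.injEq] at h
  obtain ⟨rfl, rfl, rfl⟩ := h
  exact he

theorem wordCount_equiv_step_le (m : ℕ) :
    Fintype.card ι * wordCount (m + 2) (fun l => ∃ q p t, l = q :: p :: t ∧
        ∃ p₁ ∈ t.head?, r (p₁, p) (p, q) ∧ p₁ ≠ q) ≤
      Fintype.card ι ^ m * pathCount r := by
  cases m with
  | zero =>
    rw [wordCount_eq_zero, mul_zero]
    · exact Nat.zero_le _
    · rintro _ hl ⟨q, p, t, rfl, h⟩
      obtain rfl : t = [] := by simpa using hl
      simp at h
  | succ m =>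
    have hle := wordCount_le_ncard_mul (k := m + 3) (m := m) (p' := fun _ => True)
      (p := fun l => ∃ q p t, l = q :: p :: t ∧ ∃ p₁ ∈ t.head?, r (p₁, p) (p, q) ∧ p₁ ≠ q)
      (A := {t : ι × ι × ι | r (t.1, t.2.1) (t.2.1, t.2.2) ∧ t.1 ≠ t.2.2}) (Set.toFinite _)
      (fun e t => e.2.2 :: e.2.1 :: e.1 :: t) ?_
    · rw [wordCount_true] at hle
      exact (Nat.mul_le_mul_left _ hle).trans_eq (by rw [pathCount]; ring)
    · rintro _ hl ⟨q, p, _ | ⟨p₁, t⟩, rfl, h⟩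
      · simp at h
      · exact ⟨(p₁, p, q), by simpa using h, t, by simpa using hl, trivial, rfl⟩

theorem wordCount_stray_le (m : ℕ) :
    Fintype.card ι ^ 2 * wordCount (m + 2) (Stray r) ≤
      (m + 1) * Fintype.card ι ^ m * defect r := by
  have hsplit := wordCount_le_add (k := m + 2) (p := Stray r)
    (p₁ := fun l => ∃ q p t, l = q :: p :: t ∧ ∃ e ∈ edges t, r e (p, q))
    (p₂ := fun l => ∃ q p t, l = q :: p :: t ∧ ∃ p₁ ∈ t.head?, r (p₁, p) (p, q) ∧ p₁ ≠ q) <| by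
      rintro (_ | ⟨q, _ | ⟨p, t⟩⟩) - h
      · exact h.elim
      · exact h.elim
      · exact h.imp (⟨q, p, t, rfl, ·⟩) (⟨q, p, t, rfl, ·⟩)
  calc _ ≤ _ := Nat.mul_le_mul_left _ hsplit
    _ = Fintype.card ι ^ 2 * _ + Fintype.card ι * (Fintype.card ι * _) := by ring
    _ ≤ m * Fintype.card ι ^ m * equivCount r +
        Fintype.card ι * (Fintype.card ι ^ m * pathCount r) :=
      add_le_add (wordCount_equiv_edge_le r m)
        (Nat.mul_le_mul_left _ (wordCount_equiv_step_le r m))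
    _ ≤ m * Fintype.card ι ^ m * equivCount r +
        Fintype.card ι * (Fintype.card ι ^ m * pathCount r) +
        (Fintype.card ι ^ m * equivCount r +
          m * Fintype.card ι * Fintype.card ι ^ m * pathCount r) := Nat.le_add_right _ _
    _ = _ := by rw [defect]; ring

end StrayWords

section ExceptionalWalks

variable {ι : Type*}

/-- A walk in `S` which meets no equivalence class more than twice, but is not a tree walk. -/
def Exceptional (r : Setoid (ι × ι)) (S : Set (ι × ι)) (l : List ι) : Prop :=
  (∀ e ∈ edges l, e ∈ S) ∧ (∀ e ∈ edges l, visits r l e ≤ 2) ∧ ∀ s, ¬TreeWalk r S l s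

variable {r : Setoid (ι × ι)} {S : Set (ι × ι)}

/-- The walk first fails to be a tree walk by a stray step, seen from the stack. -/
theorem Exceptional.step (hswap : ∀ p q, (p, q) ∈ S → r (p, q) (q, p)) {q : ι} {l : List ι}
    (hl : l ≠ []) (h : Exceptional r S (q :: l)) : Exceptional r S l ∨
      ∃ s, TreeWalk r S l s ∧ Stray r (q :: s) ∧ numClasses r l = numClasses r (q :: l) := by
  obtain ⟨p, l, rfl⟩ := List.exists_cons_of_ne_nil hl
  obtain ⟨hS, hvisits, htree⟩ := h
  by_cases hw : ∃ s, TreeWalk r S (p :: l) s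
  swap
  · exact Or.inl ⟨fun e he => hS e (List.mem_cons_of_mem _ he), fun e he =>
      (visits_le_visits_cons r _ _ _).trans (hvisits e (List.mem_cons_of_mem _ he)),
      not_exists.1 hw⟩
  obtain ⟨s, hs⟩ := hw
  obtain ⟨t, rfl⟩ := hs.exists_stack_eq_cons
  have hold : ∃ e ∈ edges (p :: l), r e (p, q) := by
    by_contra hn
    exact htree _ (hs.push (hS _ List.mem_cons_self) hn)
  refine Or.inr ⟨p :: t, hs, ?_, (numClasses_of_old r hold).symm⟩
  obtain ⟨e, he, hr⟩ := hold
  rcases hs.equiv_stack_or_two_le_visits hswap he with ⟨e', he', hr'⟩ | htwo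
  · rcases t with _ | ⟨p₁, t⟩
    · simp at he'
    rcases List.mem_cons.1 he' with rfl | he'
    · refine Or.inr ⟨p₁, rfl, r.trans hr' hr, ?_⟩
      rintro rfl
      exact htree _ hs.pop
    · exact Or.inl ⟨e', he', r.trans hr' hr⟩
  · have := hvisits e (List.mem_cons_of_mem _ he)
    rw [visits_cons_of_equiv (r.symm hr)] at this
    omega

variable [Fintype ι]

theorem wordCount_strayStep_le_mul {k m e : ℕ} (h : 2 * e + m = k) :
    wordCount (k + 2) (fun l => ∃ q l' s, l = q :: l' ∧ s.length = m + 1 ∧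
        TreeWalk r S l' s ∧ Stray r (q :: s)) ≤
      2 ^ k * Fintype.card ι ^ e * wordCount (m + 2) (Stray r) := by
  refine wordCount_le_mul_wordCount
    (fun l s' => ∃ q l' s, l = q :: l' ∧ s' = q :: s ∧ TreeWalk r S l' s) ?_ ?_
  · rintro _ - ⟨q, l', s, rfl, hlen, hw, hs⟩
    exact ⟨q :: s, by rw [List.length_cons, hlen], hs, q, l', s, rfl, rfl, hw⟩
  · intro s' hs' _
    obtain ⟨q, s, rfl⟩ := List.exists_cons_of_length_eq_add_one hs'
    refine (wordCount_le_ncard_mul (Set.finite_singleton q) List.cons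
      (p' := fun l => TreeWalk r S l s) (m := k + 1) ?_).trans ?_
    · rintro _ hl ⟨-, _, l', _, rfl, h, hw⟩
      obtain ⟨rfl, rfl⟩ := List.cons.inj h
      exact ⟨_, rfl, l', by simpa using hl, hw, rfl⟩
    · rw [Set.ncard_singleton, one_mul]
      exact wordCount_treeWalk_stack_le k s e (by rw [List.length_cons] at hs'; omega)

theorem wordCount_strayStep_le (hswap : ∀ p q, (p, q) ∈ S → r (p, q) (q, p)) (k u : ℕ) :
    Fintype.card ι ^ 2 * wordCount (k + 2) (fun l => ∃ q l' s, l = q :: l' ∧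
        TreeWalk r S l' s ∧ Stray r (q :: s) ∧ numClasses r l' = u) ≤
      2 ^ k * (k + 1) * Fintype.card ι ^ u * defect r := by
  have hstack : ∀ l' s, l'.length = k + 1 → TreeWalk r S l' s → numClasses r l' = u →
      k ≤ 2 * u ∧ u ≤ k ∧ s.length = 2 * u - k + 1 := by
    intro l' s hl hw hu
    have hnum := hw.two_mul_numClasses hswap
    have hlen := hw.length_stack_le
    have hpos := List.length_pos_iff.2 hw.stack_ne_nil
    omega
  by_cases hu : k ≤ 2 * u ∧ u ≤ k
  swap
  · rw [wordCount_eq_zero, mul_zero]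
    · exact Nat.zero_le _
    · rintro _ hl ⟨q, l', s, rfl, hw, -, hnum⟩
      have := hstack l' s (by simpa using hl) hw hnum
      omega
  obtain ⟨m, hm⟩ := Nat.exists_eq_add_of_le hu.1
  obtain ⟨e, he⟩ := Nat.exists_eq_add_of_le hu.2
  calc _ ≤ _ := Nat.mul_le_mul_left _ <| (wordCount_mono ?_).trans
        (wordCount_strayStep_le_mul (r := r) (S := S) (show 2 * e + m = k by omega))
    _ = 2 ^ k * Fintype.card ι ^ e * (Fintype.card ι ^ 2 * wordCount (m + 2) (Stray r)) := by ring
    _ ≤ 2 ^ k * Fintype.card ι ^ e * ((m + 1) * Fintype.card ι ^ m * defect r) :=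
      Nat.mul_le_mul_left _ (wordCount_stray_le r m)
    _ = 2 ^ k * (m + 1) * Fintype.card ι ^ u * defect r := by
      rw [show u = e + m by omega]
      ring
    _ ≤ _ := by gcongr; omega
  rintro _ hl ⟨q, l', s, rfl, hw, hs, hnum⟩
  have := hstack l' s (by simpa using hl) hw hnum
  exact ⟨q, l', s, rfl, by omega, hw, hs⟩

/-- The constant in `wordCount_exceptional_le`. -/
def exceptionalBound (B : ℕ) : ℕ → ℕ
  | 0 => 0
  | k + 1 => (1 + k * B) * exceptionalBound B k + 2 ^ k * (k + 1)

theorem wordCount_exceptional_le {B : ℕ} (hswap : ∀ p q, (p, q) ∈ S → r (p, q) (q, p))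
    (hB : ∀ p q p' : ι, {q' : ι | r (p, q) (p', q')}.ncard ≤ B) (k u : ℕ) :
    Fintype.card ι ^ 2 * wordCount (k + 1) (fun l => Exceptional r S l ∧ numClasses r l = u) ≤
      exceptionalBound B k * Fintype.card ι ^ u * defect r := by
  induction k generalizing u with
  | zero =>
    rw [wordCount_eq_zero, mul_zero]
    · exact Nat.zero_le _
    · rintro l hl ⟨⟨-, -, h⟩, -⟩
      obtain ⟨p, rfl⟩ := List.length_eq_one_iff.1 hl
      exact h _ (.start p)
  | succ k ih =>
    have hsplit : wordCount (k + 2) (fun l => Exceptional r S l ∧ numClasses r l = u) ≤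
        wordCount (k + 2) (fun l => Exceptional r S l.tail ∧ numClasses r l = u) +
        wordCount (k + 2) (fun l => ∃ q l' s, l = q :: l' ∧ TreeWalk r S l' s ∧
          Stray r (q :: s) ∧ numClasses r l' = u) := by
      refine wordCount_le_add fun l hl ⟨hE, hu⟩ => ?_
      obtain ⟨q, l, rfl⟩ := List.exists_cons_of_length_eq_add_one hl
      refine (hE.step hswap ?_).imp (⟨·, hu⟩) fun ⟨s, hw, hs, hn⟩ =>
        ⟨q, l, s, rfl, hw, hs, hn.trans hu⟩
      rintro rfl
      simp at hl
    have htail := wordCount_tail_numClasses_le hB (Exceptional r S) (· = u) k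
    have hnew : Fintype.card ι ^ 2 * (Fintype.card ι *
        wordCount (k + 1) (fun l => Exceptional r S l ∧ numClasses r l + 1 = u)) ≤
        exceptionalBound B k * Fintype.card ι ^ u * defect r := by
      cases u with
      | zero => simp [wordCount_eq_zero]
      | succ u =>
        simp only [add_left_inj]
        rw [mul_left_comm]
        exact (Nat.mul_le_mul_left _ (ih u)).trans_eq (by ring)
    calc _ ≤ _ := Nat.mul_le_mul_left _ (hsplit.trans (Nat.add_le_add_right htail _))
      _ = Fintype.card ι ^ 2 * (Fintype.card ι * _) +
          k * B * (Fintype.card ι ^ 2 * _) + Fintype.card ι ^ 2 * _ := by ring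
      _ ≤ exceptionalBound B k * Fintype.card ι ^ u * defect r +
          k * B * (exceptionalBound B k * Fintype.card ι ^ u * defect r) +
          2 ^ k * (k + 1) * Fintype.card ι ^ u * defect r :=
        add_le_add (add_le_add hnew (Nat.mul_le_mul_left _ (ih u)))
          (wordCount_strayStep_le hswap k u)
      _ = _ := by rw [exceptionalBound]; ring

end ExceptionalWalks

section NegligibleWalks

variable {ι : Type*}

/-- A walk in `S` that meets each of its equivalence classes at least twice, and is not a complete
tree walk. -/
def Negligible (r : Setoid (ι × ι)) (S : Set (ι × ι)) (l : List ι) : Prop :=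
  (∀ e ∈ edges l, e ∈ S) ∧ (∀ e ∈ edges l, 2 ≤ visits r l e) ∧
    ¬∃ s, s.length = 1 ∧ TreeWalk r S l s

variable {r : Setoid (ι × ι)} {S : Set (ι × ι)}

theorem Negligible.two_mul_numClasses_lt_or_exceptional
    (hswap : ∀ p q, (p, q) ∈ S → r (p, q) (q, p)) {l : List ι} {k : ℕ} (hl : l.length = k + 1)
    (h : Negligible r S l) :
    2 * numClasses r l < k ∨ Exceptional r S l ∧ 2 * numClasses r l = k := by
  obtain ⟨hS, htwo, htree⟩ := h
  have hnum := numClasses_of_two_le_visits htwo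
  rw [hl, Nat.add_sub_cancel] at hnum
  refine hnum.imp_right fun ⟨hk, hvisits⟩ =>
    ⟨⟨hS, fun e he => (hvisits e he).le, fun s hs => ?_⟩, hk⟩
  have := hs.two_mul_numClasses hswap
  exact htree ⟨s, by omega, hs⟩

variable [Fintype ι]

theorem wordCount_two_mul_numClasses_lt_le [Nonempty ι] {B : ℕ}
    (hB : ∀ p q p' : ι, {q' : ι | r (p, q) (p', q')}.ncard ≤ B) (k : ℕ) :
    (wordCount (k + 1) (fun l => 2 * numClasses r l < k) : ℝ) ≤
      (1 + k * B) ^ k * √(Fintype.card ι) ^ (k + 1) := by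
  rcases k with _ | k
  · simp [wordCount_eq_zero]
  have hx : 1 ≤ √(Fintype.card ι : ℝ) := Real.one_le_sqrt.2 (mod_cast Fintype.card_pos)
  calc (wordCount (k + 2) (fun l => 2 * numClasses r l < k + 1) : ℝ)
      ≤ wordCount (k + 2) fun l => numClasses r l ≤ k / 2 := by
        exact_mod_cast wordCount_mono fun l _ h => by omega
    _ ≤ (1 + (k + 1 : ℕ) * B) ^ (k + 1) * (Fintype.card ι : ℝ) ^ (k / 2 + 1) := by
        exact_mod_cast wordCount_numClasses_le hB (k + 1) (k / 2)
    _ = (1 + (k + 1 : ℕ) * B) ^ (k + 1) * √(Fintype.card ι) ^ (2 * (k / 2 + 1)) := by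
        rw [pow_mul, Real.sq_sqrt (Nat.cast_nonneg _)]
    _ ≤ _ := by gcongr; omega

theorem wordCount_exceptional_le_sqrt [Nonempty ι] {B : ℕ}
    (hswap : ∀ p q, (p, q) ∈ S → r (p, q) (q, p))
    (hB : ∀ p q p' : ι, {q' : ι | r (p, q) (p', q')}.ncard ≤ B) (k : ℕ) :
    (wordCount (k + 1) (fun l => Exceptional r S l ∧ 2 * numClasses r l = k) : ℝ) ≤
      exceptionalBound B k * √(Fintype.card ι) ^ (k + 2) *
        (defect r / (Fintype.card ι : ℝ) ^ 3) := by
  have hN : (0 : ℝ) < Fintype.card ι := mod_cast Fintype.card_pos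
  by_cases hk : ∃ u, 2 * u = k
  · obtain ⟨u, rfl⟩ := hk
    have hle : (Fintype.card ι : ℝ) ^ 2 *
        wordCount (2 * u + 1) (fun l => Exceptional r S l ∧ numClasses r l = u) ≤
          exceptionalBound B (2 * u) * (Fintype.card ι : ℝ) ^ u * defect r := by
      exact_mod_cast wordCount_exceptional_le hswap hB (2 * u) u
    simp only [mul_right_inj' two_ne_zero]
    refine le_of_mul_le_mul_left (hle.trans_eq ?_) (pow_pos hN 2)
    rw [← mul_add_one, pow_mul, Real.sq_sqrt hN.le]
    field_simp
    ring
  · rw [wordCount_eq_zero fun l _ h => hk ⟨_, h.2⟩, Nat.cast_zero]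
    positivity

theorem wordCount_negligible_le [Nonempty ι] {B : ℕ}
    (hswap : ∀ p q, (p, q) ∈ S → r (p, q) (q, p))
    (hB : ∀ p q p' : ι, {q' : ι | r (p, q) (p', q')}.ncard ≤ B) (k : ℕ) :
    (wordCount (k + 1) (Negligible r S) : ℝ) ≤
      (1 + k * B) ^ k * √(Fintype.card ι) ^ (k + 1) +
        exceptionalBound B k * √(Fintype.card ι) ^ (k + 2) *
          (defect r / (Fintype.card ι : ℝ) ^ 3) := by
  refine le_trans ?_ (add_le_add (wordCount_two_mul_numClasses_lt_le hB k)
    (wordCount_exceptional_le_sqrt hswap hB k))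
  exact_mod_cast wordCount_le_add fun l hl (h : Negligible r S l) =>
    h.two_mul_numClasses_lt_or_exceptional hswap hl

end NegligibleWalks

section TreeCount

/-- The number of tree walks with `k` steps and final stack of length `m`. -/
noncomputable def treeCount {ι : Type*} (r : Setoid (ι × ι)) (S : Set (ι × ι)) (k m : ℕ) : ℕ :=
  wordCount (k + 1) fun l => ∃ s, s.length = m ∧ TreeWalk r S l s

/-- The number of paths with `k` steps `±1` from `1` to `m` that avoid `0`. -/
def ballot : ℕ → ℕ → ℕ
  | 0, m => if m = 1 then 1 else 0
  | _ + 1, 0 => 0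
  | k + 1, m + 1 => ballot k m + ballot k (m + 2)

variable {ι : Type*} {r : Setoid (ι × ι)} {S : Set (ι × ι)}

theorem treeCount_zero_right (k : ℕ) : treeCount r S k 0 = 0 := by
  refine wordCount_eq_zero ?_
  rintro l - ⟨s, hs, hw⟩
  exact hw.stack_ne_nil (List.length_eq_zero_iff.1 hs)

theorem treeCount_le_wordCount_pop [Finite ι] (k m : ℕ) :
    treeCount r S k (m + 2) ≤ wordCount (k + 2) fun l =>
      (∃ s, s.length = m + 2 ∧ TreeWalk r S l.tail s) ∧
        ∃ s, s.length = m + 1 ∧ TreeWalk r S l s := by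
  rw [← one_mul (wordCount _ _)]
  refine wordCount_le_mul_wordCount (fun l l' => l'.tail = l) ?_ ?_
  · rintro l hl ⟨s, hs, hw⟩
    obtain ⟨p, l, rfl⟩ := List.exists_cons_of_length_eq_add_one hl
    obtain ⟨t, rfl⟩ := hw.exists_stack_eq_cons
    obtain ⟨q, t, rfl⟩ := List.exists_cons_of_length_eq_add_one (Nat.succ.inj hs)
    exact ⟨q :: p :: l, by simpa using hl, ⟨⟨_, hs, hw⟩, _, by simpa using hs, hw.pop⟩, rfl⟩
  · intro l _ _
    refine (Set.ncard_le_one (finite_setOf_word _ _)).2 ?_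
    rintro _ ⟨-, -, rfl⟩ _ ⟨-, -, rfl⟩
    rfl

variable [Fintype ι]

theorem treeCount_zero_left (m : ℕ) : treeCount r S 0 m = ballot 0 m * Fintype.card ι := by
  rw [ballot]
  split_ifs with h
  · rw [one_mul, ← pow_one (Fintype.card ι), ← wordCount_true]
    refine le_antisymm (wordCount_mono fun _ _ _ => trivial) (wordCount_mono fun l hl _ => ?_)
    obtain ⟨p, rfl⟩ := List.length_eq_one_iff.1 hl
    exact ⟨[p], h.symm, .start p⟩
  · rw [zero_mul]
    refine wordCount_eq_zero ?_
    rintro l hl ⟨s, hs, hw⟩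
    obtain ⟨p, rfl⟩ := List.length_eq_one_iff.1 hl
    cases hw
    exact h hs.symm

section Bounds

variable (hswap : ∀ p q, (p, q) ∈ S → r (p, q) (q, p))

include hswap

theorem treeCount_succ_le (k m : ℕ) :
    treeCount r S (k + 1) (m + 1) ≤
      Fintype.card ι * treeCount r S k m + treeCount r S k (m + 2) := by
  have hsplit : treeCount r S (k + 1) (m + 1) ≤
      wordCount (k + 2) (fun l => ∃ s, s.length = m ∧ TreeWalk r S l.tail s) +
        wordCount (k + 2) (fun l => ∃ p q s, s.length = m ∧ TreeWalk r S l.tail (p :: q :: s) ∧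
          l.head? = some q) := by
    refine wordCount_le_add ?_
    rintro l hl ⟨s, hs, hw⟩
    cases hw with
    | start => simp at hl
    | push hw => exact Or.inl ⟨_, by simpa using hs, hw⟩
    | pop hw => exact Or.inr ⟨_, _, _, by simpa using hs, hw, rfl⟩
  refine hsplit.trans (add_le_add (wordCount_tail (k + 1) fun l =>
    ∃ s, s.length = m ∧ TreeWalk r S l s).le ?_)
  rw [← one_mul (treeCount r S k (m + 2))]
  refine wordCount_succ_le_mul (fun _ _ _ h => ?_) fun l _ _ => ?_
  · obtain ⟨p, q, s, hs, hw, -⟩ := h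
    exact ⟨p :: q :: s, by simp [hs], hw⟩
  · refine (Set.ncard_le_one (Set.toFinite _)).2 ?_
    rintro q ⟨p, _, s, -, hw, hq⟩ q' ⟨p', _, s', -, hw', hq'⟩
    obtain rfl := Option.some.inj hq
    obtain rfl := Option.some.inj hq'
    have := hw.stack_unique hswap hw'
    simp only [List.cons.injEq] at this
    exact this.2.1

theorem le_treeCount_succ {B D : ℕ}
    (hB : ∀ p q p' : ι, {q' : ι | r (p, q) (p', q')}.ncard ≤ B)
    (hS : ∀ p, {q | (p, q) ∉ S}.ncard ≤ D) (k m : ℕ) :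
    Fintype.card ι * treeCount r S k m + treeCount r S k (m + 2) ≤
      treeCount r S (k + 1) (m + 1) + (D + k * B) * treeCount r S k m := by
  let tree (m : ℕ) (l : List ι) : Prop := ∃ s, s.length = m ∧ TreeWalk r S l s
  have hsplit : wordCount (k + 2) (fun l => tree m l.tail) ≤
      wordCount (k + 2) (fun l => tree m l.tail ∧ tree (m + 1) l) +
        wordCount (k + 2) (fun l => tree m l.tail ∧ ¬tree (m + 1) l) :=
    wordCount_le_add fun l _ h => (em (tree (m + 1) l)).imp (⟨h, ·⟩) (⟨h, ·⟩)
  have hfail : wordCount (k + 2) (fun l => tree m l.tail ∧ ¬tree (m + 1) l) ≤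
      (D + k * B) * treeCount r S k m := by
    refine wordCount_succ_le_mul (fun _ _ _ h => h.1) ?_
    rintro l hl ⟨s, hs, hw⟩
    obtain ⟨p, l, rfl⟩ := List.exists_cons_of_length_eq_add_one hl
    obtain ⟨t, rfl⟩ := hw.exists_stack_eq_cons
    have hold := ncard_setOf_exists_edge_le hB p (edges (p :: l))
    rw [length_edges, hl, Nat.add_sub_cancel] at hold
    refine (Set.ncard_le_ncard ?_ (Set.toFinite _)).trans
      ((Set.ncard_union_le _ _).trans (add_le_add (hS p) hold))
    rintro q ⟨-, hq⟩
    by_contra h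
    simp only [Set.mem_union, Set.mem_ofPred_eq, not_or, not_not] at h
    exact hq ⟨q :: p :: t, by simpa using hs, hw.push h.1 h.2⟩
  have hdisj : wordCount (k + 2) (fun l => tree m l.tail ∧ tree (m + 1) l) +
      wordCount (k + 2) (fun l => tree (m + 2) l.tail ∧ tree (m + 1) l) ≤
        treeCount r S (k + 1) (m + 1) := by
    refine wordCount_add_le (fun _ h => h.2) (fun _ h => h.2) ?_
    rintro l ⟨⟨s, hs, hw⟩, -⟩ ⟨⟨s', hs', hw'⟩, -⟩
    rw [hw.stack_unique hswap hw'] at hs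
    omega
  have htail : wordCount (k + 2) (fun l => tree m l.tail) = Fintype.card ι * treeCount r S k m :=
    wordCount_tail _ _
  have hpop : treeCount r S k (m + 2) ≤
      wordCount (k + 2) (fun l => tree (m + 2) l.tail ∧ tree (m + 1) l) :=
    treeCount_le_wordCount_pop k m
  linarith

theorem abs_treeCount_succ_sub_le [Nonempty ι] {B D : ℕ}
    (hB : ∀ p q p' : ι, {q' : ι | r (p, q) (p', q')}.ncard ≤ B)
    (hS : ∀ p, {q | (p, q) ∉ S}.ncard ≤ D) (k m : ℕ) :
    |(treeCount r S k m / √(Fintype.card ι) ^ (k + m + 1) +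
          treeCount r S k (m + 2) / √(Fintype.card ι) ^ (k + (m + 2) + 1)) -
        treeCount r S (k + 1) (m + 1) / √(Fintype.card ι) ^ (k + 1 + (m + 1) + 1)| ≤
      (D + k * B) / Fintype.card ι * (treeCount r S k m / √(Fintype.card ι) ^ (k + m + 1)) := by
  have hN : (0 : ℝ) < Fintype.card ι := mod_cast Fintype.card_pos
  have hx : 0 < √(Fintype.card ι : ℝ) := Real.sqrt_pos.2 hN
  have hx2 : (Fintype.card ι : ℝ) = √(Fintype.card ι : ℝ) ^ 2 := (Real.sq_sqrt hN.le).symm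
  have hup : (treeCount r S (k + 1) (m + 1) : ℝ) ≤
      Fintype.card ι * treeCount r S k m + treeCount r S k (m + 2) := by
    exact_mod_cast treeCount_succ_le hswap k m
  have hlow : (Fintype.card ι * treeCount r S k m + treeCount r S k (m + 2) : ℝ) ≤
      treeCount r S (k + 1) (m + 1) + (D + k * B) * treeCount r S k m := by
    exact_mod_cast le_treeCount_succ hswap hB hS k m
  rw [hx2] at hup hlow ⊢
  rw [Real.sqrt_sq hx.le]
  generalize √(Fintype.card ι : ℝ) = x at *
  have hrew : ∀ a b c : ℝ, a / x ^ (k + m + 1) + b / x ^ (k + (m + 2) + 1) -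
      c / x ^ (k + 1 + (m + 1) + 1) = (x ^ 2 * a + b - c) / x ^ (k + m + 3) := by
    intro a b c
    field_simp
    ring
  rw [hrew, abs_of_nonneg (div_nonneg (sub_nonneg.2 hup) (by positivity)), div_mul_div_comm,
    ← pow_add, add_comm 2]
  gcongr
  linarith

end Bounds

theorem tendsto_treeCount {ι : ℕ → Type*} [∀ n, Fintype (ι n)] {r : ∀ n, Setoid (ι n × ι n)}
    {S : ∀ n, Set (ι n × ι n)} {B : ℕ} {D : ℕ → ℕ}
    (hcard : Tendsto (fun n => Fintype.card (ι n)) atTop atTop)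
    (hswap : ∀ n p q, (p, q) ∈ S n → r n (p, q) (q, p))
    (hB : ∀ n, ∀ p q p' : ι n, {q' : ι n | r n (p, q) (p', q')}.ncard ≤ B)
    (hS : ∀ n p, {q | (p, q) ∉ S n}.ncard ≤ D n)
    (hD : (fun n => (D n : ℝ)) =o[atTop] fun n => (Fintype.card (ι n) : ℝ)) (k m : ℕ) :
    Tendsto (fun n => (treeCount (r n) (S n) k m : ℝ) / √(Fintype.card (ι n)) ^ (k + m + 1))
      atTop (𝓝 (ballot k m)) := by
  have hcard' : Tendsto (fun n => (Fintype.card (ι n) : ℝ)) atTop atTop :=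
    tendsto_natCast_atTop_atTop.comp hcard
  have hpos : ∀ᶠ n in atTop, 0 < Fintype.card (ι n) := hcard.eventually_gt_atTop 0
  induction k generalizing m with
  | zero =>
    refine tendsto_const_nhds.congr' ?_
    filter_upwards [hpos] with n hn
    have hN : (0 : ℝ) < Fintype.card (ι n) := mod_cast hn
    rw [treeCount_zero_left, ballot]
    split_ifs with h
    · rw [h, zero_add, Real.sq_sqrt hN.le, one_mul, div_self hN.ne', Nat.cast_one]
    · simp
  | succ k ih =>
    rcases m with _ | m
    · simp [treeCount_zero_right, ballot]
    have hsum := (ih m).add (ih (m + 2))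
    have hratio : Tendsto (fun n => (D n + k * B : ℝ) / Fintype.card (ι n)) atTop (𝓝 0) := by
      simpa only [add_div, add_zero] using
        hD.tendsto_div_nhds_zero.add (hcard'.const_div_atTop (k * B : ℝ))
    have herror := hratio.mul (ih m)
    rw [zero_mul] at herror
    have hdiff := squeeze_zero_norm' (f := fun n =>
      ((treeCount (r n) (S n) k m : ℝ) / √(Fintype.card (ι n)) ^ (k + m + 1) +
          treeCount (r n) (S n) k (m + 2) / √(Fintype.card (ι n)) ^ (k + (m + 2) + 1)) -
        treeCount (r n) (S n) (k + 1) (m + 1) /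
          √(Fintype.card (ι n)) ^ (k + 1 + (m + 1) + 1)) (hpos.mono fun n hn =>
      have := Fintype.card_pos_iff.1 hn
      abs_treeCount_succ_sub_le (hswap n) (hB n) (hS n) k m) herror
    simpa only [sub_sub_cancel, sub_zero, ballot, Nat.cast_add] using hsum.sub hdiff

end TreeCount

section Defect

theorem equivCount_le {ι : Type*} [Fintype ι] (r : Setoid (ι × ι)) :
    equivCount r ≤ Fintype.card ι * Finset.univ.sup fun p : ι =>
      {t : ι × ι × ι | r (p, t.1) (t.2.1, t.2.2)}.ncard := by
  classical
  have hsum : equivCount r = ∑ p, {t : ι × ι × ι | r (p, t.1) (t.2.1, t.2.2)}.ncard := by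
    simp only [equivCount, Set.ncard_eq_toFinset_card', Set.toFinset_ofPred, Finset.card_filter,
      Fintype.sum_prod_type]
  rw [hsum, ← smul_eq_mul, ← Finset.card_univ]
  exact Finset.sum_le_card_nsmul _ _ _ fun p hp =>
    Finset.le_sup (f := fun p : ι => {t : ι × ι × ι | r (p, t.1) (t.2.1, t.2.2)}.ncard) hp

theorem tendsto_defect_div {ι : ℕ → Type} [∀ n, Fintype (ι n)] {r : ∀ n, Setoid (ι n × ι n)}
    (hW1 : ConditionW1 ι r) (hW3 : ConditionW3 ι r) :
    Tendsto (fun n => (defect (r n) : ℝ) / (Fintype.card (ι n) : ℝ) ^ 3) atTop (𝓝 0) := by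
  have hsum := hW1.tendsto_div_nhds_zero.add hW3.tendsto_div_nhds_zero
  rw [add_zero] at hsum
  refine squeeze_zero (fun n => by positivity) (fun n => ?_) hsum
  rcases (Fintype.card (ι n)).eq_zero_or_pos with h0 | hpos
  · simp [h0]
  have hN : (Fintype.card (ι n) : ℝ) ≠ 0 := mod_cast hpos.ne'
  rw [← add_div, pow_succ', ← mul_div_mul_left (_ + _) _ hN, mul_add]
  gcongr
  exact_mod_cast Nat.add_le_add_right (equivCount_le (r n)) _

theorem tendsto_wordCount_negligible_div {ι : ℕ → Type} [∀ n, Fintype (ι n)]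
    {r : ∀ n, Setoid (ι n × ι n)} {S : ∀ n, Set (ι n × ι n)} {B : ℕ}
    (hcard : Tendsto (fun n => Fintype.card (ι n)) atTop atTop)
    (hswap : ∀ n p q, (p, q) ∈ S n → r n (p, q) (q, p)) (hW1 : ConditionW1 ι r)
    (hB : ∀ n, ∀ p q p' : ι n, {q' : ι n | r n (p, q) (p', q')}.ncard ≤ B)
    (hW3 : ConditionW3 ι r) (k : ℕ) :
    Tendsto (fun n => (wordCount (k + 1) (Negligible (r n) (S n)) : ℝ) /
      √(Fintype.card (ι n)) ^ (k + 2)) atTop (𝓝 0) := by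
  have hsqrt : Tendsto (fun n => √(Fintype.card (ι n) : ℝ)) atTop atTop :=
    Real.tendsto_sqrt_atTop.comp (tendsto_natCast_atTop_atTop.comp hcard)
  have hbound := (hsqrt.const_div_atTop ((1 + k * B : ℝ) ^ k)).add
    ((tendsto_defect_div hW1 hW3).const_mul (exceptionalBound B k : ℝ))
  rw [mul_zero, add_zero] at hbound
  refine squeeze_zero' (.of_forall fun n => by positivity) ?_ hbound
  filter_upwards [hcard.eventually_gt_atTop 0, hsqrt.eventually_gt_atTop 0] with n hn hx
  have := Fintype.card_pos_iff.1 hn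
  rw [div_le_iff₀ (pow_pos hx _)]
  refine (wordCount_negligible_le (hswap n) (hB n) k).trans_eq ?_
  field_simp
  ring

end Defect

section TraceFormula

variable {ι : Type*} [Fintype ι] [DecidableEq ι] {R : Type*} [CommSemiring R]

theorem pow_apply_eq_sum_walks (A : Matrix ι ι R) (k : ℕ) (p q : ι) :
    (A ^ k) p q = ∑ l ∈ words ι (k + 1) with l.head? = some q ∧ l.getLast? = some p,
      ((edges l).map fun e => A e.1 e.2).prod := by
  rw [Finset.sum_filter]
  induction k generalizing q with
  | zero =>
    simp only [pow_zero, sum_words_succ, sum_words_zero]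
    rcases eq_or_ne p q with rfl | h
    · simp
    · rw [Matrix.one_apply_ne h, eq_comm]
      refine Finset.sum_eq_zero fun x _ => if_neg ?_
      rintro ⟨hq, hp⟩
      exact h ((Option.some.inj hp).symm.trans (Option.some.inj hq))
  | succ k ih =>
    rw [pow_succ, Matrix.mul_apply, sum_words_succ]
    simp only [ih, Finset.sum_mul]
    rw [Finset.sum_comm, Finset.sum_comm (s := Finset.univ)]
    refine Finset.sum_congr rfl fun l hl => ?_
    obtain ⟨y, l, rfl⟩ := List.exists_cons_of_length_eq_add_one (mem_words.1 hl)
    simp only [List.head?_cons, Option.some.injEq, List.getLast?_cons_cons, edges_cons_cons,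
      List.map_cons, List.prod_cons, ite_and, ite_mul, zero_mul, Finset.sum_ite_eq,
      Finset.sum_ite_eq', Finset.mem_univ, if_true, mul_comm (A y q)]

theorem trace_pow_eq_sum_walks (A : Matrix ι ι R) (k : ℕ) :
    (A ^ k).trace = ∑ l ∈ words ι (k + 1) with l.head? = l.getLast?,
      ((edges l).map fun e => A e.1 e.2).prod := by
  simp only [Matrix.trace, Matrix.diag_apply, pow_apply_eq_sum_walks, Finset.sum_filter]
  rw [Finset.sum_comm]
  refine Finset.sum_congr rfl fun l hl => ?_
  obtain ⟨y, l, rfl⟩ := List.exists_cons_of_length_eq_add_one (mem_words.1 hl)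
  simp only [List.head?_cons, Option.some.injEq, ite_and, Finset.sum_ite_eq, Finset.mem_univ,
    if_true, eq_comm]

end TraceFormula

section EntryProducts

variable {ι Ω : Type*} {a : ι → ι → Ω → ℂ}

/-- The product of the entries of a random matrix along a list of index pairs. -/
def entryProd (a : ι → ι → Ω → ℂ) (L : List (ι × ι)) (ω : Ω) : ℂ :=
  (L.map fun e => a e.1 e.2 ω).prod

@[simp] theorem entryProd_nil (ω : Ω) : entryProd a [] ω = 1 := rfl

@[simp] theorem entryProd_cons (e : ι × ι) (L : List (ι × ι)) (ω : Ω) :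
    entryProd a (e :: L) ω = a e.1 e.2 ω * entryProd a L ω := rfl

theorem entryProd_perm {L L' : List (ι × ι)} (h : L.Perm L') (ω : Ω) :
    entryProd a L ω = entryProd a L' ω :=
  (h.map _).prod_eq

theorem enorm_entryProd (L : List (ι × ι)) (ω : Ω) :
    ‖entryProd a L ω‖ₑ = (L.map fun e => ‖a e.1 e.2 ω‖ₑ).prod := by
  induction L with
  | nil => simp
  | cons e L ih => rw [entryProd_cons, enorm_mul, ih, List.map_cons, List.prod_cons]

variable [MeasurableSpace Ω] {P : Measure Ω} {r : Setoid (ι × ι)}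

/-- Independence of entries belonging to distinct equivalence classes: each entry is independent of
the family of all entries that are not equivalent to it. -/
def IndepOffClass (P : Measure Ω) (a : ι → ι → Ω → ℂ) (r : Setoid (ι × ι)) : Prop :=
  ∀ p q, IndepFun (a p q) (fun ω (t : {t : ι × ι // ¬r (p, q) t}) => a t.1.1 t.1.2 ω) P

theorem measurable_entryProd (hmeas : ∀ p q, Measurable (a p q)) (L : List (ι × ι)) :
    Measurable (entryProd a L) := by
  induction L with
  | nil => exact measurable_const
  | cons e L ih => exact (hmeas e.1 e.2).mul ih

theorem IndepOffClass.integral_mul_entryProd (hindep : IndepOffClass P a r)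
    (hmeas : ∀ p q, Measurable (a p q)) {φ : ℂ → ℂ} (hφ : Measurable φ) {p q : ι}
    {L : List (ι × ι)} (hL : ∀ e ∈ L, ¬r (p, q) e) :
    ∫ ω, φ (a p q ω) * entryProd a L ω ∂P =
      (∫ ω, φ (a p q ω) ∂P) * ∫ ω, entryProd a L ω ∂P := by
  obtain ⟨ψ, hψ, hψL⟩ : ∃ ψ : ({t : ι × ι // ¬r (p, q) t} → ℂ) → ℂ, Measurable ψ ∧
      (ψ ∘ fun ω t => a t.1.1 t.1.2 ω) = entryProd a L := by
    induction L with
    | nil => exact ⟨fun _ => 1, measurable_const, rfl⟩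
    | cons e L ih =>
      obtain ⟨ψ, hψ, hψL⟩ := ih fun e' he' => hL e' (List.mem_cons_of_mem _ he')
      refine ⟨fun g => g ⟨e, hL e List.mem_cons_self⟩ * ψ g, (measurable_pi_apply _).mul hψ, ?_⟩
      ext ω
      rw [entryProd_cons, ← hψL]
      rfl
  have hcomp : IndepFun (φ ∘ a p q) (entryProd a L) P := hψL ▸ (hindep p q).comp hφ hψ
  exact hcomp.integral_fun_mul_eq_mul_integral (hφ.comp (hmeas p q)).aestronglyMeasurable
    (measurable_entryProd hmeas L).aestronglyMeasurable

theorem IndepOffClass.integral_entryProd_eq_zero (hindep : IndepOffClass P a r)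
    (hmeas : ∀ p q, Measurable (a p q)) (hcent : ∀ p q, ∫ ω, a p q ω ∂P = 0) {l : List ι}
    {e : ι × ι} (he : e ∈ edges l) (hvisit : visits r l e < 2) :
    ∫ ω, entryProd a (edges l) ω ∂P = 0 := by
  obtain ⟨L₁, L₂, hL⟩ := List.append_of_mem he
  have hperm : (edges l).Perm (e :: (L₁ ++ L₂)) := hL ▸ List.perm_middle
  have hne : ∀ e' ∈ L₁ ++ L₂, ¬r e e' := by
    classical
    intro e' he' hr
    have hpos : 0 < ((L₁ ++ L₂).map (Quotient.mk r)).count (Quotient.mk r e) :=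
      List.count_pos_iff.2 (Quotient.sound hr ▸ List.mem_map_of_mem he')
    rw [visits, classList, (hperm.map _).count_eq, List.map_cons, List.count_cons_self] at hvisit
    omega
  simp only [entryProd_perm hperm, entryProd_cons]
  exact (hindep.integral_mul_entryProd hmeas measurable_id hne).trans
    (mul_eq_zero_of_left (hcent _ _) _)

theorem prod_le_one_add_sum_pow (L : List ℝ≥0∞) :
    L.prod ≤ 1 + (L.map fun x => x ^ L.length).sum := by
  rcases eq_or_ne L [] with rfl | hL
  · simp
  obtain ⟨x, hx, hmax⟩ := L.toFinset.exists_max_image id ((List.toFinset_nonempty_iff L).2 hL)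
  rw [List.mem_toFinset] at hx
  calc L.prod ≤ x ^ L.length :=
        List.prod_le_pow_card L x fun y hy => hmax y (List.mem_toFinset.2 hy)
    _ ≤ (L.map fun x => x ^ L.length).sum :=
        List.single_le_sum (fun _ _ => zero_le) _ (List.mem_map_of_mem hx)
    _ ≤ _ := le_add_self

theorem lintegral_sum_map {α : Type*} {f : α → Ω → ℝ≥0∞} (hf : ∀ x, Measurable (f x))
    (L : List α) : ∫⁻ ω, (L.map fun x => f x ω).sum ∂P = (L.map fun x => ∫⁻ ω, f x ω ∂P).sum := by
  induction L with
  | nil => simp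
  | cons x L ih => simp only [List.map_cons, List.sum_cons, lintegral_add_left (hf x), ih]

theorem lintegral_enorm_entryProd_le [IsProbabilityMeasure P] (hmeas : ∀ p q, Measurable (a p q))
    {k : ℕ} {K : ℝ≥0} (hK : ∀ p q, ∫⁻ ω, ‖a p q ω‖ₑ ^ k ∂P ≤ K) {L : List (ι × ι)}
    (hL : L.length = k) :
    ∫⁻ ω, ‖entryProd a L ω‖ₑ ∂P ≤ 1 + k * K := by
  subst hL
  have hle : ∀ ω, ‖entryProd a L ω‖ₑ ≤ 1 + (L.map fun e => ‖a e.1 e.2 ω‖ₑ ^ L.length).sum := by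
    intro ω
    simpa only [enorm_entryProd, List.map_map, List.length_map, Function.comp_def] using
      prod_le_one_add_sum_pow (L.map fun e => ‖a e.1 e.2 ω‖ₑ)
  calc ∫⁻ ω, ‖entryProd a L ω‖ₑ ∂P
      ≤ ∫⁻ ω, 1 + (L.map fun e => ‖a e.1 e.2 ω‖ₑ ^ L.length).sum ∂P := lintegral_mono hle
    _ = 1 + (L.map fun e => ∫⁻ ω, ‖a e.1 e.2 ω‖ₑ ^ L.length ∂P).sum := by
        rw [lintegral_add_left measurable_const, lintegral_one, measure_univ,
          lintegral_sum_map fun e : ι × ι => (hmeas e.1 e.2).enorm.pow_const _]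
    _ ≤ 1 + L.length * K := by
        gcongr
        simpa using List.sum_le_sum fun e (_ : e ∈ L) => hK e.1 e.2

theorem integrable_entryProd [IsProbabilityMeasure P] (hmeas : ∀ p q, Measurable (a p q))
    {k : ℕ} {K : ℝ≥0} (hK : ∀ p q, ∫⁻ ω, ‖a p q ω‖ₑ ^ k ∂P ≤ K) {L : List (ι × ι)}
    (hL : L.length = k) :
    Integrable (entryProd a L) P :=
  ⟨(measurable_entryProd hmeas L).aestronglyMeasurable,
    (lintegral_enorm_entryProd_le hmeas hK hL).trans_lt (by finiteness)⟩

theorem norm_integral_entryProd_le [IsProbabilityMeasure P] (hmeas : ∀ p q, Measurable (a p q))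
    {k : ℕ} {K : ℝ≥0} (hK : ∀ p q, ∫⁻ ω, ‖a p q ω‖ₑ ^ k ∂P ≤ K) {L : List (ι × ι)}
    (hL : L.length = k) :
    ‖∫ ω, entryProd a L ω ∂P‖ ≤ 1 + k * K := by
  have h : ‖∫ ω, entryProd a L ω ∂P‖ₑ ≤ (1 + k * K : ℝ≥0) := by
    push_cast
    exact (enorm_integral_le_lintegral_enorm _).trans (lintegral_enorm_entryProd_le hmeas hK hL)
  exact_mod_cast enorm_le_coe.1 h

end EntryProducts

section WignerFamily

variable {ι Ω : Type*} [MeasurableSpace Ω]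

/-- Centered random variables `a p q` that form a hermitian matrix, are independent off the classes
of `r`, have unit variance on `S` and vanish off `S`. -/
structure IsWignerFamily (P : Measure Ω) (a : ι → ι → Ω → ℂ) (r : Setoid (ι × ι))
    (S : Set (ι × ι)) : Prop where
  measurable : ∀ p q, Measurable (a p q)
  indep : IndepOffClass P a r
  conj_symm : ∀ p q ω, a q p ω = starRingEnd ℂ (a p q ω)
  centered : ∀ p q, ∫ ω, a p q ω ∂P = 0
  variance : ∀ p q, (p, q) ∈ S → ∫ ω, a p q ω * starRingEnd ℂ (a p q ω) ∂P = 1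
  eq_zero : ∀ p q, (p, q) ∉ S → ∀ ω, a p q ω = 0

namespace IsWignerFamily

variable {P : Measure Ω} {a : ι → ι → Ω → ℂ} {r : Setoid (ι × ι)} {S : Set (ι × ι)}

/-- Otherwise `a p q` and its conjugate `a q p` would be independent, and the variance of `a p q`
would be the product of their means. -/
theorem equiv_swap (h : IsWignerFamily P a r S) (p q : ι) (hpq : (p, q) ∈ S) :
    r (p, q) (q, p) := by
  by_contra hne
  have hprod := h.indep.integral_mul_entryProd h.measurable measurable_id (p := p) (q := q)
    (L := [(q, p)]) (by simpa using hne)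
  simp only [id, entryProd_cons, entryProd_nil, mul_one, h.conj_symm p q, h.variance p q hpq,
    h.centered, zero_mul] at hprod
  exact one_ne_zero hprod

variable [IsProbabilityMeasure P]

theorem integral_entryProd_pairs (h : IsWignerFamily P a r S) {F : List (ι × ι)}
    (hF : ∀ e ∈ F, e ∈ S) (hpair : F.Pairwise fun e e' => ¬r e e') :
    ∫ ω, entryProd a (F.flatMap fun e => [e, e.swap]) ω ∂P = 1 := by
  induction F with
  | nil => simp
  | cons e F ih =>
    rw [List.pairwise_cons] at hpair
    have hne : ∀ e' ∈ F.flatMap (fun e => [e, e.swap]), ¬r e e' := by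
      intro e' he' hr
      simp only [List.mem_flatMap, List.mem_cons, List.not_mem_nil, or_false] at he'
      obtain ⟨f, hf, rfl | rfl⟩ := he'
      · exact hpair.1 _ hf hr
      · have hswap := h.equiv_swap _ _ (hF f (List.mem_cons_of_mem _ hf))
        exact hpair.1 _ hf (r.trans hr (r.symm hswap))
    have hsplit := h.indep.integral_mul_entryProd h.measurable (φ := fun z => z * starRingEnd ℂ z)
      (by fun_prop) hne
    rw [ih (fun e he => hF e (List.mem_cons_of_mem _ he)) hpair.2,
      h.variance _ _ (hF e List.mem_cons_self), one_mul] at hsplit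
    simpa only [List.flatMap_cons, List.cons_append, List.nil_append, entryProd_cons,
      Prod.fst_swap, Prod.snd_swap, h.conj_symm e.1 e.2, mul_assoc] using hsplit

theorem integral_entryProd_treeWalk (h : IsWignerFamily P a r S) {l s : List ι}
    (hw : TreeWalk r S l s) (hs : s.length = 1) : ∫ ω, entryProd a (edges l) ω ∂P = 1 := by
  obtain ⟨F, hF, hpair, hperm⟩ := hw.exists_edges_perm
  obtain ⟨p, rfl⟩ := List.length_eq_one_iff.1 hs
  simp only [edges_singleton, List.append_nil] at hF hpair hperm
  simp only [entryProd_perm hperm]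
  exact h.integral_entryProd_pairs (fun e he => (hF e he).1) hpair

omit [IsProbabilityMeasure P] in
theorem integral_entryProd_eq_zero (h : IsWignerFamily P a r S) {l : List ι}
    (hneg : ¬Negligible r S l) (htree : ¬∃ s, s.length = 1 ∧ TreeWalk r S l s) :
    ∫ ω, entryProd a (edges l) ω ∂P = 0 := by
  by_cases hS : ∀ e ∈ edges l, e ∈ S
  · obtain ⟨e, he, hvisit⟩ : ∃ e ∈ edges l, visits r l e < 2 := by
      by_contra! hvisit
      exact hneg ⟨hS, hvisit, htree⟩
    exact h.indep.integral_entryProd_eq_zero h.measurable h.centered he hvisit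
  · push Not at hS
    obtain ⟨e, he, heS⟩ := hS
    have hzero : ∀ ω, entryProd a (edges l) ω = 0 := fun ω =>
      List.prod_eq_zero (List.mem_map.2 ⟨e, he, h.eq_zero _ _ heS ω⟩)
    simp [hzero]

open Classical in
theorem norm_integral_entryProd_sub_le (h : IsWignerFamily P a r S) {k : ℕ} {K : ℝ≥0}
    (hK : ∀ p q, ∫⁻ ω, ‖a p q ω‖ₑ ^ k ∂P ≤ K) {l : List ι} (hl : l.length = k + 1) :
    ‖∫ ω, entryProd a (edges l) ω ∂P -
        if ∃ s, s.length = 1 ∧ TreeWalk r S l s then 1 else 0‖ ≤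
      if Negligible r S l then (1 + k * K : ℝ) else 0 := by
  split_ifs with htree hneg hneg
  · exact absurd htree hneg.2.2
  · obtain ⟨s, hs, hw⟩ := htree
    rw [h.integral_entryProd_treeWalk hw hs, sub_self, norm_zero]
  · rw [sub_zero]
    exact norm_integral_entryProd_le h.measurable hK (by rw [length_edges, hl, Nat.add_sub_cancel])
  · rw [h.integral_entryProd_eq_zero hneg htree, sub_self, norm_zero]

theorem norm_sum_integral_entryProd_sub_treeCount_le [Finite ι] [DecidableEq ι]
    (h : IsWignerFamily P a r S) {k : ℕ} {K : ℝ≥0} (hK : ∀ p q, ∫⁻ ω, ‖a p q ω‖ₑ ^ k ∂P ≤ K) :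
    ‖∑ l ∈ words ι (k + 1) with l.head? = l.getLast?, ∫ ω, entryProd a (edges l) ω ∂P -
        treeCount r S k 1‖ ≤ (1 + k * K) * wordCount (k + 1) (Negligible r S) := by
  classical
  have hclosed : ∀ l : List ι, (∃ s, s.length = 1 ∧ TreeWalk r S l s) → l.head? = l.getLast? := by
    rintro (_ | ⟨p, l⟩) ⟨s, hs, hw⟩
    · rfl
    obtain ⟨t, rfl⟩ := hw.exists_stack_eq_cons
    obtain rfl := List.length_eq_zero_iff.1 (Nat.succ.inj hs)
    exact hw.getLast?_stack
  have hcount : (treeCount r S k 1 : ℂ) =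
      ∑ l ∈ words ι (k + 1) with l.head? = l.getLast?,
        if ∃ s, s.length = 1 ∧ TreeWalk r S l s then 1 else 0 := by
    rw [treeCount, wordCount_eq_card, Finset.sum_boole, Finset.filter_filter]
    simp only [and_iff_right_of_imp (hclosed _)]
  calc _ ≤ ∑ l ∈ words ι (k + 1) with l.head? = l.getLast?,
        if Negligible r S l then (1 + k * K : ℝ) else 0 := by
        rw [hcount, ← Finset.sum_sub_distrib]
        exact norm_sum_le_of_le _ fun l hl =>
          h.norm_integral_entryProd_sub_le hK (mem_words.1 (Finset.mem_filter.1 hl).1)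
    _ ≤ ∑ l ∈ words ι (k + 1), if Negligible r S l then (1 + k * K : ℝ) else 0 :=
        Finset.sum_le_sum_of_subset_of_nonneg (Finset.filter_subset _ _) fun _ _ _ => by positivity
    _ = _ := by
        rw [wordCount_eq_card, ← Finset.sum_filter, Finset.sum_const, nsmul_eq_mul, mul_comm]

end IsWignerFamily

end WignerFamily

section ScaledMatrix

variable {ι : Type} [Fintype ι] [DecidableEq ι] {Ω : Type*} {a : ι → ι → Ω → ℂ}

theorem trace_scaledMatrix_pow (k : ℕ) (ω : Ω) : (scaledMatrix a ω ^ k).trace =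
    ((1 / √(Fintype.card ι) : ℝ) : ℂ) ^ k *
      ∑ l ∈ words ι (k + 1) with l.head? = l.getLast?, entryProd a (edges l) ω := by
  have hsmul : scaledMatrix a ω =
      ((1 / √(Fintype.card ι) : ℝ) : ℂ) • Matrix.of fun p q => a p q ω := rfl
  rw [hsmul, smul_pow, Matrix.trace_smul, smul_eq_mul, trace_pow_eq_sum_walks]
  rfl

variable [MeasurableSpace Ω] {P : Measure Ω} [IsProbabilityMeasure P] {k : ℕ} {K : ℝ≥0}

omit [Fintype ι] in
theorem integrable_entryProd_edges [Finite ι] (hmeas : ∀ p q, Measurable (a p q))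
    (hK : ∀ p q, ∫⁻ ω, ‖a p q ω‖ₑ ^ k ∂P ≤ K) {l : List ι}
    (hl : l ∈ (words ι (k + 1)).filter fun l => l.head? = l.getLast?) :
    Integrable (entryProd a (edges l)) P :=
  integrable_entryProd hmeas hK <| by
    rw [length_edges, mem_words.1 (Finset.mem_filter.1 hl).1, Nat.add_sub_cancel]

theorem integrable_trace_scaledMatrix_pow (hmeas : ∀ p q, Measurable (a p q))
    (hK : ∀ p q, ∫⁻ ω, ‖a p q ω‖ₑ ^ k ∂P ≤ K) :
    Integrable (fun ω => (scaledMatrix a ω ^ k).trace) P := by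
  simp only [trace_scaledMatrix_pow]
  exact (integrable_finsetSum _ fun l hl => integrable_entryProd_edges hmeas hK hl).const_mul _

theorem integral_trace_scaledMatrix_pow (hmeas : ∀ p q, Measurable (a p q))
    (hK : ∀ p q, ∫⁻ ω, ‖a p q ω‖ₑ ^ k ∂P ≤ K) :
    ∫ ω, (scaledMatrix a ω ^ k).trace ∂P = ((1 / √(Fintype.card ι) : ℝ) : ℂ) ^ k *
      ∑ l ∈ words ι (k + 1) with l.head? = l.getLast?, ∫ ω, entryProd a (edges l) ω ∂P := by
  simp only [trace_scaledMatrix_pow, integral_const_mul]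
  rw [integral_finsetSum _ fun l hl => integrable_entryProd_edges hmeas hK hl]

theorem IsWignerFamily.norm_integral_trace_scaledMatrix_pow_sub_le [Nonempty ι]
    {r : Setoid (ι × ι)} {S : Set (ι × ι)} (h : IsWignerFamily P a r S)
    (hK : ∀ p q, ∫⁻ ω, ‖a p q ω‖ₑ ^ k ∂P ≤ K) :
    ‖(∫ ω, (scaledMatrix a ω ^ k).trace ∂P) / Fintype.card ι -
        (treeCount r S k 1 / √(Fintype.card ι) ^ (k + 2) : ℝ)‖ ≤
      (1 + k * K) * (wordCount (k + 1) (Negligible r S) / √(Fintype.card ι) ^ (k + 2)) := by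
  have hN : (0 : ℝ) < Fintype.card ι := mod_cast Fintype.card_pos
  have hx : 0 < √(Fintype.card ι : ℝ) := Real.sqrt_pos.2 hN
  have hx2 : (Fintype.card ι : ℂ) = (√(Fintype.card ι : ℝ) : ℂ) ^ 2 := by
    rw [← Complex.ofReal_pow, Real.sq_sqrt hN.le, Complex.ofReal_natCast]
  have hx0 : (√(Fintype.card ι : ℝ) : ℂ) ≠ 0 := Complex.ofReal_ne_zero.2 hx.ne'
  have hdiv : ∀ z : ℂ, ((1 / √(Fintype.card ι) : ℝ) : ℂ) ^ k * z / Fintype.card ι -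
      (treeCount r S k 1 / √(Fintype.card ι) ^ (k + 2) : ℝ) =
        (z - treeCount r S k 1) / (√(Fintype.card ι) : ℂ) ^ (k + 2) := by
    intro z
    rw [hx2]
    push_cast
    rw [one_div, inv_pow]
    field_simp
    ring
  rw [integral_trace_scaledMatrix_pow h.measurable hK, hdiv, norm_div, norm_pow,
    Complex.norm_of_nonneg hx.le, ← mul_div_assoc]
  gcongr
  exact h.norm_sum_integral_entryProd_sub_treeCount_le hK

end ScaledMatrix

theorem tendsto_integral_trace_scaledMatrix_pow {ι : ℕ → Type} [∀ n, Fintype (ι n)]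
    [∀ n, DecidableEq (ι n)] {Ω : ℕ → Type*} [∀ n, MeasurableSpace (Ω n)]
    {P : ∀ n, Measure (Ω n)} [∀ n, IsProbabilityMeasure (P n)] {a : ∀ n, ι n → ι n → Ω n → ℂ}
    {r : ∀ n, Setoid (ι n × ι n)} {S : ∀ n, Set (ι n × ι n)} {D : ℕ → ℕ} {k : ℕ} {K : ℝ≥0}
    (h : ∀ n, IsWignerFamily (P n) (a n) (r n) (S n))
    (hcard : Tendsto (fun n => Fintype.card (ι n)) atTop atTop)
    (hS : ∀ n p, {q | (p, q) ∉ S n}.ncard ≤ D n)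
    (hD : (fun n => (D n : ℝ)) =o[atTop] fun n => (Fintype.card (ι n) : ℝ))
    (hW1 : ConditionW1 ι r) (hW2 : ConditionW2 ι r) (hW3 : ConditionW3 ι r)
    (hK : ∀ n p q, ∫⁻ ω, ‖a n p q ω‖ₑ ^ k ∂(P n) ≤ K) :
    Tendsto (fun n => (∫ ω, (scaledMatrix (a n) ω ^ k).trace ∂(P n)).re / Fintype.card (ι n))
      atTop (𝓝 (ballot k 1)) := by
  obtain ⟨B, hB⟩ := hW2
  have htree := tendsto_treeCount hcard (fun n => (h n).equiv_swap) hB hS hD k 1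
  have herror := (tendsto_wordCount_negligible_div hcard (fun n => (h n).equiv_swap) hW1 hB hW3
    k).const_mul (1 + k * K : ℝ)
  rw [mul_zero] at herror
  have hdiff := squeeze_zero_norm' (f := fun n =>
    (∫ ω, (scaledMatrix (a n) ω ^ k).trace ∂(P n)) / Fintype.card (ι n) -
      (treeCount (r n) (S n) k 1 / √(Fintype.card (ι n)) ^ (k + 2) : ℝ))
    ((hcard.eventually_gt_atTop 0).mono fun n hn =>
      have := Fintype.card_pos_iff.1 hn
      (h n).norm_integral_trace_scaledMatrix_pow_sub_le (hK n)) herror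
  have hre := ((Complex.continuous_re.tendsto 0).comp hdiff).add htree
  simpa only [Function.comp_apply, Complex.sub_re, Complex.ofReal_re, Complex.div_natCast_re,
    sub_add_cancel, Complex.zero_re, zero_add] using hre

section SemicircleMoments

open Real

theorem integral_cos_int_mul {c : ℤ} (hc : c ≠ 0) : ∫ θ in (0 : ℝ)..π, cos (c * θ) = 0 := by
  rw [intervalIntegral.integral_comp_mul_left cos (Int.cast_ne_zero.2 hc), integral_cos, mul_zero,
    sin_zero, sin_int_mul_pi, sub_zero, smul_zero]

theorem integral_sin_nat_mul_mul_sin (m : ℕ) :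
    ∫ θ in (0 : ℝ)..π, sin (m * θ) * sin θ = if m = 1 then π / 2 else 0 := by
  split_ifs with hm
  · subst hm
    simp only [Nat.cast_one, one_mul, ← sq, integral_sin_sq, sin_zero, sin_pi, zero_mul, sub_zero,
      zero_add]
  · have hprod : ∀ θ : ℝ, sin (m * θ) * sin θ =
        2⁻¹ * (cos ((m - 1 : ℤ) * θ) - cos ((m + 1 : ℤ) * θ)) := by
      intro θ
      push_cast
      rw [sub_mul, add_mul, one_mul, cos_sub, cos_add]
      ring
    have hcont : ∀ c : ℤ, IntervalIntegrable (fun θ => cos (c * θ)) volume 0 π := fun c =>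
      (by fun_prop : Continuous _).intervalIntegrable _ _
    simp only [hprod]
    rw [intervalIntegral.integral_const_mul, intervalIntegral.integral_sub (hcont _) (hcont _),
      integral_cos_int_mul (by omega), integral_cos_int_mul (by omega), sub_zero, mul_zero]

theorem integral_two_cos_pow_mul_sin_mul_sin (k m : ℕ) :
    2 / π * ∫ θ in (0 : ℝ)..π, (2 * cos θ) ^ k * (sin (m * θ) * sin θ) = ballot k m := by
  induction k generalizing m with
  | zero =>
    simp only [pow_zero, one_mul, integral_sin_nat_mul_mul_sin, ballot]
    split_ifs
    · field_simp
      exact Nat.cast_one.symm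
    · rw [mul_zero, Nat.cast_zero]
  | succ k ih =>
    cases m with
    | zero => simp [ballot]
    | succ m =>
      have hsplit : ∀ θ : ℝ, (2 * cos θ) ^ (k + 1) * (sin ((m + 1 : ℕ) * θ) * sin θ) =
          (2 * cos θ) ^ k * (sin (m * θ) * sin θ) +
          (2 * cos θ) ^ k * (sin ((m + 2 : ℕ) * θ) * sin θ) := by
        intro θ
        have hm : (m : ℝ) * θ = (m + 1 : ℕ) * θ - θ := by push_cast; ring
        have hm2 : ((m + 2 : ℕ) : ℝ) * θ = (m + 1 : ℕ) * θ + θ := by push_cast; ring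
        rw [hm, hm2, sin_sub, sin_add]
        ring
      have hcont : ∀ c : ℕ, IntervalIntegrable
          (fun θ => (2 * cos θ) ^ k * (sin (c * θ) * sin θ)) volume 0 π := fun c =>
        (by fun_prop : Continuous _).intervalIntegrable _ _
      simp only [hsplit]
      rw [intervalIntegral.integral_add (hcont _) (hcont _), mul_add, ih, ih, ballot, Nat.cast_add]

/-- The density of the semicircle law. -/
noncomputable def semicircleDensity (x : ℝ) : ℝ :=
  1 / (2 * π) * (Set.Icc (-2 : ℝ) 2).indicator (fun x => √(4 - x ^ 2)) x

theorem semicircleDensity_nonneg (x : ℝ) : 0 ≤ semicircleDensity x :=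
  mul_nonneg (by positivity) (Set.indicator_nonneg (fun _ _ => sqrt_nonneg _) _)

theorem semicircleDensity_eq_zero {x : ℝ} (hx : x ∉ Set.Icc (-2 : ℝ) 2) :
    semicircleDensity x = 0 := by
  rw [semicircleDensity, Set.indicator_of_notMem hx, mul_zero]

theorem measurable_semicircleDensity : Measurable semicircleDensity :=
  measurable_const.mul (Measurable.indicator (by fun_prop) measurableSet_Icc)

theorem semicircleLaw_eq_withDensity :
    semicircleLaw = volume.withDensity fun x => ENNReal.ofReal (semicircleDensity x) := rfl

theorem semicircleLaw_compl_Icc : semicircleLaw (Set.Icc (-2 : ℝ) 2)ᶜ = 0 := by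
  rw [semicircleLaw_eq_withDensity, withDensity_apply _ measurableSet_Icc.compl]
  refine (setLIntegral_congr_fun measurableSet_Icc.compl fun x hx => ?_).trans lintegral_zero
  rw [semicircleDensity_eq_zero hx, ENNReal.ofReal_zero]

theorem integral_semicircleLaw (f : ℝ → ℝ) :
    ∫ x, f x ∂semicircleLaw = ∫ x in (-2)..2, 1 / (2 * π) * √(4 - x ^ 2) * f x := by
  rw [semicircleLaw_eq_withDensity, integral_withDensity_eq_integral_toReal_smul
    measurable_semicircleDensity.ennreal_ofReal (ae_of_all _ fun _ => ENNReal.ofReal_lt_top),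
    intervalIntegral.integral_of_le (by norm_num), ← integral_Icc_eq_integral_Ioc,
    ← integral_indicator measurableSet_Icc]
  refine integral_congr_ae (ae_of_all _ fun x => ?_)
  simp only [ENNReal.toReal_ofReal (semicircleDensity_nonneg _), smul_eq_mul]
  by_cases hx : x ∈ Set.Icc (-2 : ℝ) 2
  · rw [semicircleDensity, Set.indicator_of_mem hx, Set.indicator_of_mem hx]
  · rw [semicircleDensity_eq_zero hx, Set.indicator_of_notMem hx, zero_mul]

theorem integral_semicircleLaw_eq_integral_cos {f : ℝ → ℝ} (hf : Continuous f) :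
    ∫ x, f x ∂semicircleLaw =
      2 / π * ∫ θ in (0 : ℝ)..π, f (2 * cos θ) * (sin θ * sin θ) := by
  have hsubst := intervalIntegral.integral_comp_mul_deriv (a := 0) (b := π)
    (f := fun θ => 2 * cos θ) (f' := fun θ => 2 * -sin θ)
    (g := fun x => 1 / (2 * π) * √(4 - x ^ 2) * f x)
    (fun x _ => (hasDerivAt_cos x).const_mul 2) (by fun_prop) (by fun_prop)
  simp only [cos_zero, cos_pi, mul_one, mul_neg, Function.comp_def] at hsubst
  rw [integral_semicircleLaw, intervalIntegral.integral_symm, ← hsubst,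
    ← intervalIntegral.integral_neg, ← intervalIntegral.integral_const_mul]
  refine intervalIntegral.integral_congr fun θ hθ => ?_
  rw [Set.uIcc_of_le pi_pos.le] at hθ
  have hsin : √(4 - (2 * cos θ) ^ 2) = 2 * sin θ := by
    rw [show 4 - (2 * cos θ) ^ 2 = (2 * sin θ) ^ 2 by linarith [sin_sq_add_cos_sq θ]]
    exact sqrt_sq (mul_nonneg two_pos.le (sin_nonneg_of_mem_Icc hθ))
  simp only [hsin]
  field_simp

theorem integral_pow_semicircleLaw (k : ℕ) : ∫ x, x ^ k ∂semicircleLaw = ballot k 1 := by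
  rw [integral_semicircleLaw_eq_integral_cos (continuous_pow k),
    ← integral_two_cos_pow_mul_sin_mul_sin]
  simp only [Nat.cast_one, one_mul]

instance isProbabilityMeasure_semicircleLaw : IsProbabilityMeasure semicircleLaw := by
  have hone := integral_pow_semicircleLaw 0
  simp only [pow_zero, integral_const, smul_eq_mul, mul_one, ballot, if_true, Nat.cast_one] at hone
  exact isProbabilityMeasure_iff_real.2 hone

end SemicircleMoments

section MethodOfMoments

open Polynomial

theorem abs_sub_eval_le_mul_pow (f : ℝ →ᵇ ℝ) (p : ℝ[X]) {x : ℝ} (hx : 1 ≤ |x|) :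
    |f x - p.eval x| ≤
      (‖f‖ + ∑ i ∈ Finset.range (p.natDegree + 1), |p.coeff i|) * |x| ^ p.natDegree := by
  have hf : |f x| ≤ ‖f‖ * |x| ^ p.natDegree :=
    (f.norm_coe_le_norm x).trans (le_mul_of_one_le_right (norm_nonneg _) (one_le_pow₀ hx))
  have hp : |p.eval x| ≤
      (∑ i ∈ Finset.range (p.natDegree + 1), |p.coeff i|) * |x| ^ p.natDegree := by
    rw [eval_eq_sum_range, Finset.sum_mul]
    refine (Finset.abs_sum_le_sum_abs _ _).trans (Finset.sum_le_sum fun i hi => ?_)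
    rw [abs_mul, abs_pow]
    gcongr
    exact Nat.lt_succ_iff.1 (Finset.mem_range.1 hi)
  rw [add_mul]
  exact (abs_sub _ _).trans (add_le_add hf hp)

/-- Outside a large interval the error of a Weierstrass approximation of `f` is dominated by a high
even power, which is small on `[-R, R]`. -/
theorem exists_polynomial_abs_sub_eval_le (f : ℝ →ᵇ ℝ) {R ε : ℝ} (hR : 0 ≤ R) (hε : 0 < ε) :
    ∃ p q : ℝ[X], (∀ x, |f x - p.eval x| ≤ q.eval x) ∧ ∀ x, |x| ≤ R → q.eval x ≤ ε := by
  have hR1 : 0 < R + 1 := by positivity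
  obtain ⟨p, hp⟩ := exists_polynomial_near_of_continuousOn (-(R + 1)) (R + 1) f
    f.continuous.continuousOn (ε / 2) (half_pos hε)
  obtain ⟨c, hc, hpc⟩ : ∃ c, 0 ≤ c ∧ ∀ x, R + 1 ≤ |x| →
      |f x - p.eval x| ≤ c * (|x| / (R + 1)) ^ p.natDegree := by
    refine ⟨(‖f‖ + ∑ i ∈ Finset.range (p.natDegree + 1), |p.coeff i|) * (R + 1) ^ p.natDegree,
      by positivity, fun x hx => ?_⟩
    rw [mul_assoc, ← mul_pow, mul_div_cancel₀ _ hR1.ne']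
    exact abs_sub_eval_le_mul_pow f p (by linarith)
  obtain ⟨j, hj, hjε⟩ : ∃ j, p.natDegree ≤ j ∧ c * (R / (R + 1)) ^ j < ε / 2 := by
    have hpow := (tendsto_pow_atTop_nhds_zero_of_lt_one (by positivity : 0 ≤ R / (R + 1))
      ((div_lt_one hR1).2 (lt_add_one R))).const_mul c
    rw [mul_zero] at hpow
    exact ((eventually_ge_atTop _).and (hpow.eventually_lt_const (half_pos hε))).exists
  have heval : ∀ x, (C (ε / 2) + C c * (C (R + 1)⁻¹ * X) ^ (2 * j)).eval x =
      ε / 2 + c * (|x| / (R + 1)) ^ (2 * j) := by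
    intro x
    simp only [eval_add, eval_mul, eval_pow, eval_C, eval_X, div_eq_inv_mul, mul_pow,
      pow_mul |x|, pow_mul x, sq_abs]
  refine ⟨p, _, fun x => (?_ : _ ≤ _).trans_eq (heval x).symm,
    fun x hx => (heval x).trans_le ?_⟩
  · rcases le_total |x| (R + 1) with hx | hx
    · rw [abs_sub_comm]
      exact (hp x (abs_le.1 hx)).le.trans (le_add_of_nonneg_right (by positivity))
    · refine ((hpc x hx).trans ?_).trans (le_add_of_nonneg_left (half_pos hε).le)
      gcongr
      · exact (one_le_div hR1).2 hx
      · omega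
  · have hle : (|x| / (R + 1)) ^ (2 * j) ≤ (R / (R + 1)) ^ j := by
      calc _ ≤ (R / (R + 1)) ^ (2 * j) := by gcongr
        _ ≤ _ := pow_le_pow_of_le_one (by positivity) ((div_le_one hR1).2 (by linarith)) (by omega)
    linarith [mul_le_mul_of_nonneg_left hle hc]

variable {μ : Measure ℝ}

theorem integrable_eval (hμ : ∀ k : ℕ, Integrable (fun x : ℝ => x ^ k) μ) (p : ℝ[X]) :
    Integrable (fun x => p.eval x) μ := by
  simp only [eval_eq_sum_range]
  exact integrable_finsetSum _ fun i _ => (hμ i).const_mul _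

theorem integral_eval (hμ : ∀ k : ℕ, Integrable (fun x : ℝ => x ^ k) μ) (p : ℝ[X]) :
    ∫ x, p.eval x ∂μ = ∑ i ∈ Finset.range (p.natDegree + 1), p.coeff i * ∫ x, x ^ i ∂μ := by
  simp only [eval_eq_sum_range]
  rw [integral_finsetSum _ fun i _ => (hμ i).const_mul _]
  simp only [integral_const_mul]

theorem abs_integral_sub_integral_eval_le (hμ : ∀ k : ℕ, Integrable (fun x : ℝ => x ^ k) μ)
    {f : ℝ →ᵇ ℝ} {p q : ℝ[X]} (hpq : ∀ x, |f x - p.eval x| ≤ q.eval x) :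
    |∫ x, f x ∂μ - ∫ x, p.eval x ∂μ| ≤ ∫ x, q.eval x ∂μ := by
  have hfin : IsFiniteMeasure μ := by
    simpa only [pow_zero, integrable_const_iff, one_ne_zero, false_or] using hμ 0
  rw [← integral_sub (f.integrable μ) (integrable_eval hμ p)]
  exact norm_integral_le_of_norm_le (f := fun x => f x - p.eval x) (integrable_eval hμ q)
    (ae_of_all _ hpq)

theorem convergesWeakly_of_tendsto_moments {μ : ℕ → Measure ℝ} {ν : Measure ℝ}
    [IsFiniteMeasure ν] {K : Set ℝ}
    (hK : IsCompact K) (hν : ∀ᵐ x ∂ν, x ∈ K)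
    (hμ : ∀ᶠ n in atTop, ∀ k : ℕ, Integrable (fun x : ℝ => x ^ k) (μ n))
    (hm : ∀ k : ℕ, Tendsto (fun n => ∫ x, x ^ k ∂(μ n)) atTop (𝓝 (∫ x, x ^ k ∂ν))) :
    ConvergesWeakly μ ν := by
  obtain ⟨R, hR, hKR⟩ := hK.isBounded.exists_pos_norm_le
  have hνR : ∀ᵐ x ∂ν, |x| ≤ R := hν.mono hKR
  have hνint : ∀ k : ℕ, Integrable (fun x : ℝ => x ^ k) ν := fun k =>
    Integrable.of_bound (C := R ^ k) (by fun_prop) <| hνR.mono fun x hx => by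
      rw [norm_pow]
      exact pow_le_pow_left₀ (norm_nonneg x) hx k
  have hpoly : ∀ p : ℝ[X],
      Tendsto (fun n => ∫ x, p.eval x ∂(μ n)) atTop (𝓝 (∫ x, p.eval x ∂ν)) := by
    intro p
    rw [integral_eval hνint]
    exact (tendsto_finsetSum _ fun i _ => (hm i).const_mul (p.coeff i)).congr'
      (hμ.mono fun n hn => (integral_eval hn p).symm)
  intro f
  rw [Metric.tendsto_nhds]
  intro δ hδ
  obtain ⟨ε, hε, hεδ⟩ := exists_pos_mul_lt (by positivity : 0 < δ / 3) (ν.real Set.univ)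
  obtain ⟨p, q, hpq, hq⟩ := exists_polynomial_abs_sub_eval_le f hR.le hε
  have hqν : ∫ x, q.eval x ∂ν < δ / 3 := by
    calc _ ≤ ∫ _, ε ∂ν :=
          integral_mono_ae (integrable_eval hνint q) (integrable_const ε) (hνR.mono hq)
      _ < _ := by rwa [integral_const, smul_eq_mul]
  filter_upwards [hμ, Metric.tendsto_nhds.1 (hpoly p) (δ / 3) (by positivity),
    (hpoly q).eventually_lt_const hqν] with n hn hpn hqn
  have hfμ := abs_integral_sub_integral_eval_le hn hpq
  have hfν := abs_integral_sub_integral_eval_le hνint hpq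
  rw [Real.dist_eq, abs_lt] at hpn ⊢
  rw [abs_le] at hfμ hfν
  constructor <;> linarith

end MethodOfMoments

section TraceFunctionalCalculus

variable {ι : Type*} [Fintype ι] [DecidableEq ι]

theorem trace_cfc {M : Matrix ι ι ℂ} (hM : M.IsHermitian) (f : ℝ → ℝ) :
    (cfc f M).trace = ((∑ j, f (hM.eigenvalues j) : ℝ) : ℂ) := by
  rw [hM.cfc_eq, Matrix.IsHermitian.cfc, Unitary.conjStarAlgAut_apply, Matrix.trace_mul_comm,
    ← mul_assoc, Unitary.coe_star_mul_self, one_mul, Matrix.trace_diagonal, Complex.ofReal_sum]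
  rfl

theorem trace_pow_eq_sum_eigenvalues {M : Matrix ι ι ℂ} (hM : M.IsHermitian) (k : ℕ) :
    (M ^ k).trace = ((∑ j, hM.eigenvalues j ^ k : ℝ) : ℂ) := by
  rw [← trace_cfc hM fun x => x ^ k, cfc_pow_id M k hM.isSelfAdjoint]

theorem continuous_sum_eigenvalues {f : ℝ → ℝ} (hf : Continuous f) :
    Continuous fun M : {M : Matrix ι ι ℂ // M.IsHermitian} => ∑ j, f (M.2.eigenvalues j) := by
  open scoped Matrix.Norms.L2Operator in
  have hcfc : Continuous fun M : {M : Matrix ι ι ℂ // M.IsHermitian} => cfc f M.1 :=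
    continuous_subtype_val.cfc_of_mem_nhdsSet f univ_mem (fun M => M.2) hf.continuousOn
  have htrace := Complex.continuous_re.comp hcfc.matrix_trace
  simpa only [Function.comp_def, trace_cfc (Subtype.prop _), Complex.ofReal_re] using htrace

theorem measurable_sum_eigenvalues {Ω : Type*} [MeasurableSpace Ω] {X : Ω → Matrix ι ι ℂ}
    (hX : ∀ ω, (X ω).IsHermitian) (hmeas : ∀ p q, Measurable fun ω => X ω p q) {f : ℝ → ℝ}
    (hf : Continuous f) : Measurable fun ω => ∑ j, f ((hX ω).eigenvalues j) := by
  have hcont : Continuous fun M : {M : ι → ι → ℂ // Matrix.IsHermitian M} =>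
      ∑ j, f (M.2.eigenvalues j) := continuous_sum_eigenvalues hf
  have hXmeas : Measurable fun ω => (⟨X ω, hX ω⟩ : {M : ι → ι → ℂ // Matrix.IsHermitian M}) :=
    (measurable_pi_lambda _ fun p => measurable_pi_lambda _ (hmeas p)).subtype_mk
  exact (hcont.measurable.comp hXmeas :)

end TraceFunctionalCalculus

theorem measurable_of_measurable_lintegral_boundedContinuous {Ω Y : Type*} [MeasurableSpace Ω]
    [TopologicalSpace Y] [HasOuterApproxClosed Y] [MeasurableSpace Y] [BorelSpace Y]
    {μ : Ω → Measure Y} [∀ ω, IsProbabilityMeasure (μ ω)]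
    (h : ∀ f : Y →ᵇ ℝ≥0, Measurable fun ω => ∫⁻ y, f y ∂(μ ω)) : Measurable μ := by
  refine .measure_of_isPiSystem_of_isProbabilityMeasure
    (BorelSpace.measurable_eq.trans borel_eq_generateFrom_isClosed) isPiSystem_isClosed ?_
  intro F (hF : IsClosed F)
  refine measurable_of_tendsto_metrizable (fun n => h (hF.apprSeq n)) ?_
  exact tendsto_pi_nhds.2 fun ω => HasOuterApproxClosed.tendsto_lintegral_apprSeq hF (μ ω)

section EmpiricalMeasure

variable {ι : Type} [Fintype ι] [DecidableEq ι]

theorem lintegral_empiricalMeasure {M : Matrix ι ι ℂ} (hM : M.IsHermitian) (f : ℝ → ℝ≥0∞) :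
    ∫⁻ x, f x ∂(empiricalMeasure M hM) =
      (Fintype.card ι : ℝ≥0∞)⁻¹ * ∑ j, f (hM.eigenvalues j) := by
  simp only [empiricalMeasure, lintegral_smul_measure, lintegral_finsetSum_measure,
    lintegral_dirac, smul_eq_mul]

theorem integral_empiricalMeasure {M : Matrix ι ι ℂ} (hM : M.IsHermitian) (f : ℝ → ℝ) :
    ∫ x, f x ∂(empiricalMeasure M hM) =
      (Fintype.card ι : ℝ)⁻¹ * ∑ j, f (hM.eigenvalues j) := by
  rw [empiricalMeasure, integral_smul_measure,
    integral_finsetSum_measure fun _ _ => integrable_dirac enorm_lt_top]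
  simp only [integral_dirac, ENNReal.toReal_inv, ENNReal.toReal_natCast, smul_eq_mul]

variable [Nonempty ι]

theorem integrable_empiricalMeasure {M : Matrix ι ι ℂ} (hM : M.IsHermitian) (f : ℝ → ℝ) :
    Integrable f (empiricalMeasure M hM) :=
  (integrable_finsetSum_measure.2 fun _ _ => integrable_dirac enorm_lt_top).smul_measure <|
    ENNReal.inv_ne_top.2 (Nat.cast_ne_zero.2 Fintype.card_ne_zero)

instance isProbabilityMeasure_empiricalMeasure {M : Matrix ι ι ℂ} (hM : M.IsHermitian) :
    IsProbabilityMeasure (empiricalMeasure M hM) where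
  measure_univ := by
    rw [← lintegral_one, lintegral_empiricalMeasure, Finset.sum_const, nsmul_one, Finset.card_univ]
    exact ENNReal.inv_mul_cancel (Nat.cast_ne_zero.2 Fintype.card_ne_zero)
      (ENNReal.natCast_ne_top _)

variable {Ω : Type*} [MeasurableSpace Ω] {X : Ω → Matrix ι ι ℂ} (hX : ∀ ω, (X ω).IsHermitian)
  (hmeas : ∀ p q, Measurable fun ω => X ω p q)

include hmeas

theorem measurable_empiricalMeasure : Measurable fun ω => empiricalMeasure (X ω) (hX ω) := by
  refine measurable_of_measurable_lintegral_boundedContinuous fun f => ?_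
  have hsum := (measurable_sum_eigenvalues hX hmeas (f := fun x => (f x : ℝ))
    (by fun_prop)).ennreal_ofReal
  simp only [ENNReal.ofReal_sum_of_nonneg fun _ _ => NNReal.coe_nonneg _,
    ENNReal.ofReal_coe_nnreal] at hsum
  simpa only [lintegral_empiricalMeasure] using hsum.const_mul _

variable {P : Measure Ω}

theorem integrable_meanEmpiricalMeasure {f : ℝ → ℝ} (hf : Continuous f)
    (hint : Integrable (fun ω => ∑ j, ‖f ((hX ω).eigenvalues j)‖) P) :
    Integrable f (meanEmpiricalMeasure P X hX) := by
  let κ : Kernel Ω ℝ := ⟨_, measurable_empiricalMeasure hX hmeas⟩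
  refine (Measure.integrable_comp_iff (κ := κ) hf.aestronglyMeasurable).2
    ⟨ae_of_all _ fun ω => integrable_empiricalMeasure (hX ω) f, ?_⟩
  simpa only [κ, Kernel.coe_mk, integral_empiricalMeasure] using hint.const_mul _

theorem integral_meanEmpiricalMeasure {f : ℝ → ℝ}
    (hf : Integrable f (meanEmpiricalMeasure P X hX)) : ∫ x, f x ∂(meanEmpiricalMeasure P X hX) =
      (Fintype.card ι : ℝ)⁻¹ * ∫ ω, ∑ j, f ((hX ω).eigenvalues j) ∂P := by
  let κ : Kernel Ω ℝ := ⟨_, measurable_empiricalMeasure hX hmeas⟩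
  have hbind : ∫ x, f x ∂(κ ∘ₘ P) = ∫ ω, ∫ x, f x ∂(κ ω) ∂P := by
    have hf' : Integrable f (κ ∘ₘ P) := hf
    rw [Measure.comp_eq_comp_const_apply] at hf' ⊢
    rw [Kernel.integral_comp hf', Kernel.const_apply]
  simp only [κ, Kernel.coe_mk, integral_empiricalMeasure, integral_const_mul] at hbind
  exact hbind

theorem integrable_pow_meanEmpiricalMeasure [IsFiniteMeasure P]
    (hint : ∀ k : ℕ, Integrable (fun ω => (X ω ^ k).trace) P) (k : ℕ) :
    Integrable (fun x => x ^ k) (meanEmpiricalMeasure P X hX) := by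
  refine integrable_meanEmpiricalMeasure hX hmeas (continuous_pow k) ?_
  have hbound : Integrable (fun ω => ∑ j, (1 + (hX ω).eigenvalues j ^ (2 * k))) P := by
    have heven := (hint (2 * k)).re
    simp only [trace_pow_eq_sum_eigenvalues (hX _), RCLike.re_to_complex,
      Complex.ofReal_re] at heven
    simp only [Finset.sum_add_distrib]
    exact (integrable_const _).add heven
  refine hbound.mono' (measurable_sum_eigenvalues hX hmeas
    (f := fun x => ‖x ^ k‖) (by fun_prop)).aestronglyMeasurable (ae_of_all _ fun ω => ?_)
  rw [Real.norm_of_nonneg (Finset.sum_nonneg fun _ _ => norm_nonneg _)]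
  refine Finset.sum_le_sum fun j _ => ?_
  rw [Real.norm_eq_abs, mul_comm, pow_mul, ← sq_abs (_ ^ k)]
  nlinarith [sq_nonneg (|(hX ω).eigenvalues j ^ k| - 1), abs_nonneg ((hX ω).eigenvalues j ^ k)]

theorem integral_pow_meanEmpiricalMeasure [IsFiniteMeasure P]
    (hint : ∀ k : ℕ, Integrable (fun ω => (X ω ^ k).trace) P) (k : ℕ) :
    ∫ x, x ^ k ∂(meanEmpiricalMeasure P X hX) =
      (∫ ω, (X ω ^ k).trace ∂P).re / Fintype.card ι := by
  rw [integral_meanEmpiricalMeasure hX hmeas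
    (integrable_pow_meanEmpiricalMeasure hX hmeas hint k), div_eq_inv_mul]
  simp only [trace_pow_eq_sum_eigenvalues (hX _)]
  rw [integral_complex_ofReal, Complex.ofReal_re]

end EmpiricalMeasure

section ScaledMatrixEntries

variable {ι : Type} [Fintype ι] {Ω : Type*} {a : ι → ι → Ω → ℂ} {ω : Ω}

theorem inv_sqrt_card_ne_zero [Nonempty ι] : ((1 / √(Fintype.card ι) : ℝ) : ℂ) ≠ 0 := by
  have hcard : (0 : ℝ) < Fintype.card ι := mod_cast Fintype.card_pos
  exact Complex.ofReal_ne_zero.2 (one_div_pos.2 (Real.sqrt_pos.2 hcard)).ne'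

theorem scaledMatrix_apply_eq_zero_iff {p q : ι} : scaledMatrix a ω p q = 0 ↔ a p q ω = 0 :=
  have : Nonempty ι := ⟨p⟩
  mul_eq_zero_iff_left inv_sqrt_card_ne_zero

theorem isHermitian_scaledMatrix_iff :
    (scaledMatrix a ω).IsHermitian ↔ ∀ p q, a q p ω = starRingEnd ℂ (a p q ω) := by
  rw [Matrix.IsHermitian.ext_iff, forall_comm]
  refine forall₂_congr fun p q => ?_
  have : Nonempty ι := ⟨p⟩
  simp only [scaledMatrix, Matrix.of_apply, star_mul', Complex.star_def, Complex.conj_ofReal]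
  rw [mul_right_inj' inv_sqrt_card_ne_zero, eq_comm]

end ScaledMatrixEntries

namespace SymClass

/-- The position of an index within its block of length `n`; off the diagonals of the blocks no
entry is forced to vanish. -/
def blockIndex : (c : SymClass) → (n : ℕ) → c.Index n → Fin n
  | A, _, p | AI, _, p | BD, _, p => p
  | AII, _, p | C, _, p | CI, _, p | DIII, _, p => Sum.elim id id p

theorem exists_real_symmetric (n : ℕ) : ∃ Y : Matrix (Fin n) (Fin n) ℂ,
    EntriesReal Y ∧ Y.transpose = Y ∧ ∀ i j, Y i j ≠ 0 :=
  ⟨Matrix.of fun _ _ => 1, fun _ _ => Complex.one_im, rfl, fun _ _ => one_ne_zero⟩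

theorem exists_imaginary_skewSymmetric (n : ℕ) : ∃ Z : Matrix (Fin n) (Fin n) ℂ,
    EntriesImaginary Z ∧ Z.transpose = -Z ∧ ∀ i j, i ≠ j → Z i j ≠ 0 := by
  refine ⟨Matrix.of fun i j => ((i : ℂ) - j) * Complex.I, fun i j => by simp, ?_, ?_⟩
  · ext1 i j
    simp only [Matrix.transpose_apply, Matrix.of_apply, Matrix.neg_apply]
    ring
  · intro i j hij
    rw [Matrix.of_apply]
    exact mul_ne_zero (sub_ne_zero.2 (mod_cast Fin.val_ne_of_ne hij)) Complex.I_ne_zero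

theorem mem_support_of_blockIndex_ne {c : SymClass} {n : ℕ} {p q : c.Index n}
    (h : c.blockIndex n p ≠ c.blockIndex n q) : (p, q) ∈ c.support n := by
  obtain ⟨Y, hYreal, hYsymm, hY0⟩ := exists_real_symmetric n
  obtain ⟨Z, hZimag, hZskew, hZ0⟩ := exists_imaginary_skewSymmetric n
  have hYherm := conjTranspose_of_real hYreal hYsymm
  have hZherm := conjTranspose_of_imaginary hZimag hZskew
  cases c
  case A => exact ⟨Z, hZherm, hZ0 _ _ h⟩
  case AI => exact ⟨Y, ⟨hYreal, hYsymm⟩, hY0 _ _⟩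
  case BD => exact ⟨Z, ⟨hZimag, hZskew⟩, hZ0 _ _ h⟩
  case AII =>
    refine ⟨_, ⟨Z, Z, hZherm, hZskew, rfl⟩, ?_⟩
    rcases p with p | p <;> rcases q with q | q <;> simpa using hZ0 p q h
  case C =>
    refine ⟨_, ⟨Y, Y, hYherm, hYsymm, rfl⟩, ?_⟩
    rcases p with p | p <;> rcases q with q | q <;> simpa using hY0 p q
  case CI =>
    refine ⟨_, ⟨Y, Y, hYreal, hYreal, hYsymm, hYsymm, rfl⟩, ?_⟩
    rcases p with p | p <;> rcases q with q | q <;> simpa using hY0 p q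
  case DIII =>
    refine ⟨_, ⟨Z, Z, hZimag, hZimag, hZskew, hZskew, rfl⟩, ?_⟩
    rcases p with p | p <;> rcases q with q | q <;> simpa using hZ0 p q h

theorem ncard_blockIndex_eq_le (c : SymClass) (n : ℕ) (i : Fin n) :
    {q | c.blockIndex n q = i}.ncard ≤ 2 := by
  have hone : {q : Fin n | q = i}.ncard ≤ 2 := by simp
  have htwo : {q : Fin n ⊕ Fin n | Sum.elim id id q = i}.ncard ≤ 2 := by
    have hpair : {q : Fin n ⊕ Fin n | Sum.elim id id q = i} ⊆ {Sum.inl i, Sum.inr i} := by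
      rintro (q | q) rfl <;> simp
    exact (Set.ncard_le_ncard hpair).trans ((Set.ncard_insert_le _ _).trans (by simp))
  cases c
  case A | AI | BD => exact hone
  case AII | C | CI | DIII => exact htwo

theorem ncard_notMem_support_le (c : SymClass) (n : ℕ) (p : c.Index n) :
    {q | (p, q) ∉ c.support n}.ncard ≤ 2 := by
  refine (Set.ncard_le_ncard fun q hq => ?_).trans (c.ncard_blockIndex_eq_le n (c.blockIndex n p))
  by_contra hne
  exact hq (mem_support_of_blockIndex_ne (Ne.symm hne))

theorem tendsto_card_index (c : SymClass) :
    Tendsto (fun n => Fintype.card (c.Index n)) atTop atTop := by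
  refine tendsto_atTop_mono (fun n => ?_) tendsto_id
  rw [card_index]
  exact Nat.le_mul_of_pos_left n (by cases c <;> decide)

theorem isLittleO_const_card_index (c : SymClass) (x : ℝ) :
    (fun _ => x) =o[atTop] fun n => (Fintype.card (c.Index n) : ℝ) :=
  isLittleO_const_left.2 <| .inr <| tendsto_norm_atTop_atTop.comp <|
    tendsto_natCast_atTop_atTop.comp c.tendsto_card_index

variable {c : SymClass} {n : ℕ} {Ω : Type*} {a : c.Index n → c.Index n → Ω → ℂ}

theorem isWignerFamily [MeasurableSpace Ω] {P : Measure Ω} {r : Setoid (c.Index n × c.Index n)}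
    (hmeas : ∀ p q, Measurable (a p q)) (hindep : IndepOffClass P a r)
    (hcent : ∀ p q, ∫ ω, a p q ω ∂P = 0)
    (hvar : ∀ p q, (p, q) ∈ c.support n → ∫ ω, a p q ω * starRingEnd ℂ (a p q ω) ∂P = 1)
    (hmem : ∀ ω, scaledMatrix a ω ∈ c.space n) : IsWignerFamily P a r (c.support n) where
  measurable := hmeas
  indep := hindep
  conj_symm p q ω := isHermitian_scaledMatrix_iff.1 (isHermitian_of_mem (hmem ω)) p q
  centered := hcent
  variance := hvar
  eq_zero p q hpq ω := by
    by_contra hne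
    exact hpq ⟨_, hmem ω, scaledMatrix_apply_eq_zero_iff.not.2 hne⟩

end SymClass

theorem theorem3p1_general {ι : ℕ → Type} [∀ n, Fintype (ι n)] [∀ n, DecidableEq (ι n)]
    {Ω : ℕ → Type*} [∀ n, MeasurableSpace (Ω n)]
    {P : ∀ n, Measure (Ω n)} [∀ n, IsProbabilityMeasure (P n)] {a : ∀ n, ι n → ι n → Ω n → ℂ}
    {r : ∀ n, Setoid (ι n × ι n)} {S : ∀ n, Set (ι n × ι n)} {D : ℕ → ℕ}
    (h : ∀ n, IsWignerFamily (P n) (a n) (r n) (S n))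
    (hcard : Tendsto (fun n => Fintype.card (ι n)) atTop atTop)
    (hS : ∀ n p, {q | (p, q) ∉ S n}.ncard ≤ D n)
    (hD : (fun n => (D n : ℝ)) =o[atTop] fun n => (Fintype.card (ι n) : ℝ))
    (hW1 : ConditionW1 ι r) (hW2 : ConditionW2 ι r) (hW3 : ConditionW3 ι r)
    (hmom : ∀ k : ℕ, ∃ K : ℝ≥0, ∀ n p q, ∫⁻ ω, ‖a n p q ω‖ₑ ^ k ∂(P n) ≤ K) :
    ConvergesWeakly
      (fun n => meanEmpiricalMeasure (P n) (scaledMatrix (a n)) fun ω =>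
        isHermitian_scaledMatrix_iff.2 fun p q => (h n).conj_symm p q ω)
      semicircleLaw := by
  choose K hK using hmom
  have hX : ∀ n p q, Measurable fun ω => scaledMatrix (a n) ω p q := fun n p q =>
    ((h n).measurable p q).const_mul _
  have hint : ∀ n k, Integrable (fun ω => (scaledMatrix (a n) ω ^ k).trace) (P n) := fun n k =>
    integrable_trace_scaledMatrix_pow (h n).measurable (hK k n)
  have hne : ∀ᶠ n in atTop, Nonempty (ι n) :=
    (hcard.eventually_gt_atTop 0).mono fun n => Fintype.card_pos_iff.1
  refine convergesWeakly_of_tendsto_moments isCompact_Icc semicircleLaw_compl_Icc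
    (hne.mono fun n _ => integrable_pow_meanEmpiricalMeasure _ (hX n) (hint n)) fun k => ?_
  rw [integral_pow_semicircleLaw]
  exact (tendsto_integral_trace_scaledMatrix_pow h hcard hS hD hW1 hW2 hW3 (hK k)).congr'
    (hne.mono fun n _ => (integral_pow_meanEmpiricalMeasure _ (hX n) (hint n) k).symm)

theorem theorem3p1 (c : SymClass)
    {Ω : ℕ → Type*} [∀ n, MeasurableSpace (Ω n)]
    (P : ∀ n, Measure (Ω n)) [∀ n, IsProbabilityMeasure (P n)]
    -- the unscaled entries and the equivalence relations on pairs of indices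
    (a : ∀ n, c.Index n → c.Index n → Ω n → ℂ)
    (r : ∀ n, Setoid (c.Index n × c.Index n))
    (hmeas : ∀ n p q, Measurable (a n p q))
    -- each entry is independent of the family of all entries that are not equivalent to it
    (hindep : ∀ n p q, IndepFun (a n p q)
      (fun ω (t : {t : c.Index n × c.Index n // ¬ r n (p, q) t}) => a n t.1.1 t.1.2 ω) (P n))
    (hW1 : ConditionW1 c.Index r)
    (hW2 : ConditionW2 c.Index r)
    (hW3 : ConditionW3 c.Index r)
    -- uniformly bounded moments, centering, unit variance off the forced zeros
    (hmom : ∀ k : ℕ, ∃ K : ℝ≥0, ∀ n p q, ∫⁻ ω, ‖a n p q ω‖ₑ ^ k ∂(P n) ≤ K)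
    (hcent : ∀ n p q, ∫ ω, a n p q ω ∂(P n) = 0)
    (hvar : ∀ n p q, (p, q) ∈ c.support n →
      ∫ ω, a n p q ω * starRingEnd ℂ (a n p q ω) ∂(P n) = 1)
    -- all realizations of the random matrices belong to the class
    (hmem : ∀ n ω, scaledMatrix (a n) ω ∈ c.space n) :
    ConvergesWeakly
      (fun n => meanEmpiricalMeasure (P n) (scaledMatrix (a n))
        (fun ω => SymClass.isHermitian_of_mem (hmem n ω)))
      semicircleLaw := by
  exact theorem3p1_general
    (fun n => SymClass.isWignerFamily (hmeas n) (hindep n) (hcent n) (hvar n) (hmem n))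
    c.tendsto_card_index c.ncard_notMem_support_le (c.isLittleO_const_card_index _)
    hW1 hW2 hW3 hmom
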